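/- Let $p$ be a prime and let $\mathcal B_{p,\infty}$ be the quaternion algebra over $\mathbb Q$ ramified exactly at $p$ and $\infty$, presented by a $\mathbb Q$-basis $1,i,j,ij$ with $i^2=a$, $j^2=b$, $ij=-ji$ ($a,b\in\mathbb Q^\times$). Let $\mathcal O_1,\mathcal O_2\subset\mathcal B_{p,\infty}$ be maximal orders, $I$ an integral connecting ideal (a $\mathbb Z$-lattice of rank $4$ with left order $\mathcal O_1$ and right order $\mathcal O_2$, contained in $\mathcal O_1$), $d$ an integer, and $J\subset\mathcal O_2$ a left $\mathcal O_2$-ideal of rank $4$ such that $\mathcal O_1 d=I\cdot J$ (so $d\neq 0$). Then $$J=\{s\in\mathcal O_1\cap\mathcal O_2 : Is\subset\mathcal O_1 d\}.$$ Moreover, there is an algorithm which, given $d$ and $\mathbb Z$-bases of $\mathcal O_1$, $\mathcal O_2$, $I$, computes a $\mathbb Z$-basis of $J$ in quasi-linear time $\widetilde O(\log\gamma)$, where $\gamma$ is the maximum of $|d|$ and of the absolute values of the numerators and denominators of the coordinates of the given basis elements. Here all basis elements are written in the basis $1,i,j,ij$, with coordinates given as fractions of integers with positive denominators (not necessarily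 in lowest terms), both in the input and in the output. Precisely: there are a program and constants $C,k$, independent of $p,a,b$ and of all other data, such that on every such input the program halts with a $\mathbb Z$-basis of $J$ at cost at most $C\,(1+\log\gamma)\,(1+\log(1+\log\gamma))^k$. The model is a random access machine on integers with logarithmic cost: every operand is charged the bit lengths of its value and of the addresses used to reach it, addition, subtraction and tests cost linear time in the bit length $n$ of their operands, and multiplication and division with remainder cost $n(1+\lfloor\log_2 n\rfloor)^2$. -/

import Mathlib

open scoped Quaternion

/-! ### Orders and ideals in quaternion algebras over `ℚ` -/

section Quaternions

/-- The quaternion algebra `(a, b)` over the field `K` is a division algebra. For `K = ℝ` or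
`K = ℚ_[ℓ]` this says that `(a, b / ℚ)` ramifies at the corresponding place of `ℚ`. -/
def IsRamifiedOver (K : Type) [Field K] (a b : ℚ) : Prop :=
  ∀ x : ℍ[K, (a : K), (b : K)], x ≠ 0 → IsUnit x

/-- The algebra `ℍ[ℚ, a, b]`, with `ℚ`-basis `1, i, j, ij`, `i² = a`, `j² = b`, `ij = -ji`, is the
quaternion algebra over `ℚ` ramified exactly at `p` and `∞`. -/
structure IsBpInfty (p : ℕ) (a b : ℚ) : Prop where
  a_ne_zero : a ≠ 0
  b_ne_zero : b ≠ 0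
  ramified_infty : IsRamifiedOver ℝ a b
  ramified_iff : ∀ (l : ℕ) [Fact l.Prime], IsRamifiedOver ℚ_[l] a b ↔ l = p

variable {a b : ℚ}

/-- A `ℤ`-lattice of rank `4`. (Finite generation is needed: `ℚ` also has `ℤ`-rank `1`.) -/
def IsFullLattice (L : Submodule ℤ ℍ[ℚ, a, b]) : Prop :=
  L.FG ∧ Module.finrank ℤ L = 4

/-- An order: a subring which is a lattice of rank `4`. -/
def IsQuatOrder (O : Subalgebra ℤ ℍ[ℚ, a, b]) : Prop :=
  IsFullLattice (Subalgebra.toSubmodule O)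

/-- A maximal order: an order not contained in a strictly larger order. -/
def IsMaximalQuatOrder (O : Subalgebra ℤ ℍ[ℚ, a, b]) : Prop :=
  IsQuatOrder O ∧ ∀ O' : Subalgebra ℤ ℍ[ℚ, a, b], IsQuatOrder O' → O ≤ O' → O' = O

/-- The left order `{α : αI ⊆ I}`. -/
def leftOrder (I : Submodule ℤ ℍ[ℚ, a, b]) : Set ℍ[ℚ, a, b] :=
  {α | ∀ x ∈ I, α * x ∈ I}

/-- The right order `{α : Iα ⊆ I}`. -/
def rightOrder (I : Submodule ℤ ℍ[ℚ, a, b]) : Set ℍ[ℚ, a, b] :=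
  {α | ∀ x ∈ I, x * α ∈ I}

/-- `I` is an integral connecting ideal for `O₁` and `O₂`. -/
structure IsConnectingIdeal (O₁ O₂ : Subalgebra ℤ ℍ[ℚ, a, b]) (I : Submodule ℤ ℍ[ℚ, a, b]) :
    Prop where
  lattice : IsFullLattice I
  left_eq : leftOrder I = O₁
  right_eq : rightOrder I = O₂
  integral : (I : Set ℍ[ℚ, a, b]) ⊆ leftOrder I

/-- `J` is a left ideal of `O`, of rank `4`. -/
structure IsLeftIdeal (O : Subalgebra ℤ ℍ[ℚ, a, b]) (J : Submodule ℤ ℍ[ℚ, a, b]) : Prop where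
  lattice : IsFullLattice J
  le_order : J ≤ Subalgebra.toSubmodule O
  mul_mem : ∀ x ∈ O, ∀ y ∈ J, x * y ∈ J

/-- The left ideal `Oμ = {xμ : x ∈ O}`. -/
def principalLeftIdeal (O : Subalgebra ℤ ℍ[ℚ, a, b]) (μ : ℍ[ℚ, a, b]) :
    Submodule ℤ ℍ[ℚ, a, b] :=
  (Subalgebra.toSubmodule O).map (LinearMap.mulRight ℤ μ)

/-- `O₁`, `O₂` are maximal orders, `I` is an integral connecting ideal for them, `J` is a left
`O₂`-ideal, `d` is an integer, and `O₁d = I·J` (the product of lattices, i.e. the additive group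
generated by the products). -/
structure IsIntegerIdealDivision (O₁ O₂ : Subalgebra ℤ ℍ[ℚ, a, b])
    (I J : Submodule ℤ ℍ[ℚ, a, b]) (d : ℤ) : Prop where
  maximal₁ : IsMaximalQuatOrder O₁
  maximal₂ : IsMaximalQuatOrder O₂
  connecting : IsConnectingIdeal O₁ O₂ I
  left_ideal : IsLeftIdeal O₂ J
  factor : principalLeftIdeal O₁ (d : ℍ[ℚ, a, b]) = I * J

/-- `v` is a `ℤ`-basis of the lattice `L`. -/
def IsZBasis (v : Fin 4 → ℍ[ℚ, a, b]) (L : Submodule ℤ ℍ[ℚ, a, b]) : Prop :=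
  LinearIndependent ℤ v ∧ Submodule.span ℤ (Set.range v) = L

end Quaternions

/-! ### Random access machines with logarithmic cost -/

namespace LogRAM

/-- A memory: countably many registers, each holding an integer. -/
abbrev Mem : Type := ℕ → ℤ

/-- The length in bits of an integer (`1` for `0`). -/
def len (z : ℤ) : ℕ := max 1 (Nat.size z.natAbs)

/-- Operands: a constant, the content of a register, or indirect addressing. -/
inductive Operand : Type
  | const (z : ℤ)
  | reg (n : ℕ)
  | ind (n : ℕ)

/-- The value of an operand. -/
def Operand.val (m : Mem) : Operand → ℤ
  | .const z => z
  | .reg n => m n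
  | .ind n => m (m n).toNat

/-- The logarithmic cost of reading an operand: the lengths of all integers involved, addresses
included. -/
def Operand.cost (m : Mem) : Operand → ℕ
  | .const z => len z
  | .reg n => len n + len (m n)
  | .ind n => len n + len (m n) + len (m (m n).toNat)

/-- Destinations: a register, or indirect addressing. -/
inductive Dest : Type
  | reg (n : ℕ)
  | ind (n : ℕ)

/-- The address of a destination. -/
def Dest.addr (m : Mem) : Dest → ℕ
  | .reg n => n
  | .ind n => (m n).toNat

/-- The cost of resolving a destination. -/
def Dest.cost (m : Mem) : Dest → ℕ
  | .reg n => len n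
  | .ind n => len n + len (m n)

/-- Arithmetic instructions. -/
inductive Op : Type
  | add
  | sub
  | mul
  | div

/-- The result of an arithmetic instruction; `div` is Euclidean division of integers (nonnegative
remainder), and division by `0` gives `0`. -/
def Op.eval : Op → ℤ → ℤ → ℤ
  | .add, x, y => x + y
  | .sub, x, y => x - y
  | .mul, x, y => x * y
  | .div, x, y => x / y

/-- The cost of an arithmetic instruction on operands of total cost `n`: linear for addition and
subtraction, `n (1 + log₂ n)²` for multiplication and division, which dominates the bit complexity
of these operations. -/
def Op.cost : Op → ℕ → ℕ
  | .add, n => n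
  | .sub, n => n
  | .mul, n => n * (1 + Nat.log 2 n) ^ 2
  | .div, n => n * (1 + Nat.log 2 n) ^ 2

/-- Programs. -/
inductive Prog : Type
  | skip
  | assign (dst : Dest) (op : Op) (x y : Operand)
  | seq (P Q : Prog)
  | ifPos (x : Operand) (P Q : Prog)
  | whilePos (x : Operand) (P : Prog)

/-- `Runs P m m' t`: started on the memory `m`, the program `P` halts with memory `m'`, and the
total cost of the executed instructions is `t`. -/
inductive Runs : Prog → Mem → Mem → ℕ → Prop
  | skip (m : Mem) : Runs .skip m m 1
  | assign (m : Mem) (dst : Dest) (op : Op) (x y : Operand) :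
      Runs (.assign dst op x y) m
        (Function.update m (dst.addr m) (op.eval (x.val m) (y.val m)))
        (dst.cost m + op.cost (x.cost m + y.cost m))
  | seq {P Q : Prog} {m m' m'' : Mem} {s t : ℕ} (hP : Runs P m m' s) (hQ : Runs Q m' m'' t) :
      Runs (.seq P Q) m m'' (s + t)
  | ifPos_true {x : Operand} {P Q : Prog} {m m' : Mem} {t : ℕ} (hx : 0 < x.val m)
      (hP : Runs P m m' t) : Runs (.ifPos x P Q) m m' (x.cost m + t)
  | ifPos_false {x : Operand} {P Q : Prog} {m m' : Mem} {t : ℕ} (hx : ¬ 0 < x.val m)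
      (hQ : Runs Q m m' t) : Runs (.ifPos x P Q) m m' (x.cost m + t)
  | while_false {x : Operand} {P : Prog} {m : Mem} (hx : ¬ 0 < x.val m) :
      Runs (.whilePos x P) m m (x.cost m)
  | while_true {x : Operand} {P : Prog} {m m' m'' : Mem} {s t : ℕ} (hx : 0 < x.val m)
      (hP : Runs P m m' s) (hW : Runs (.whilePos x P) m' m'' t) :
      Runs (.whilePos x P) m m'' (x.cost m + s + t)

end LogRAM

/-! ### Bases stored in memory -/

/-- The `32` registers from address `s` on, read as `16` fractions (numerator, then denominator):
the coordinates on `1, i, j, ij` of four quaternions, one after the other. This is the `r`-th of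
the four quaternions. -/
def storedQuat (a b : ℚ) (m : LogRAM.Mem) (s : ℕ) (r : Fin 4) : ℍ[ℚ, a, b] where
  re := m (s + 8 * r) / m (s + 8 * r + 1)
  imI := m (s + 8 * r + 2) / m (s + 8 * r + 3)
  imJ := m (s + 8 * r + 4) / m (s + 8 * r + 5)
  imK := m (s + 8 * r + 6) / m (s + 8 * r + 7)

/-- The registers from address `s` on hold a `ℤ`-basis of `L`, with positive denominators. -/
def StoresBasis {a b : ℚ} (m : LogRAM.Mem) (s : ℕ) (L : Submodule ℤ ℍ[ℚ, a, b]) : Prop :=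
  (∀ e < 16, 0 < m (s + 2 * e + 1)) ∧ IsZBasis (storedQuat a b m s) L

/-- The memory `m` encodes the input: `d` in register `0`, bases of `O₁`, `O₂`, `I` from the
registers `1`, `33`, `65` on, and `0` in all registers from `97` on. -/
structure IsDivisionInput {a b : ℚ} (m : LogRAM.Mem) (O₁ O₂ : Subalgebra ℤ ℍ[ℚ, a, b])
    (I : Submodule ℤ ℍ[ℚ, a, b]) (d : ℤ) : Prop where
  integer : m 0 = d
  basis₁ : StoresBasis m 1 (Subalgebra.toSubmodule O₁)
  basis₂ : StoresBasis m 33 (Subalgebra.toSubmodule O₂)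
  basis_ideal : StoresBasis m 65 I
  blank : ∀ n, 97 ≤ n → m n = 0

/-- The maximum of the absolute values of `d` and of all numerators and denominators in the input
memory. -/
def inputHeight (m : LogRAM.Mem) : ℕ :=
  (Finset.range 97).sup fun n => (m n).natAbs

/-- `C · x · (log x)^k`, with `x` and `log x` replaced by `1 + x` and `1 + log (1 + x)` to make the
bound meaningful for small `x ≥ 0`. A quantity is `Õ(x)` if it is at most this for some constants
`C` and `k`. -/
noncomputable def softLinear (C : ℝ) (k : ℕ) (x : ℝ) : ℝ :=
  C * (1 + x) * (1 + Real.log (1 + x)) ^ k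

/-! Let `N` be the positive generator of the fractional ideal spanned by the reduced norms of
elements of `I`. Everything follows from the formula `J = (d / N) Ī`.

The arithmetic input is that `star x * y ∈ N O₂` and `y * star x ∈ N O₁` for `x, y ∈ I`. By
polarization the traces of these products are divisible by `N`, so after division by `N` one gets an
element with integral norm and integral traces against the order. Adjoining such an element `z` to
an order `O` gives the order `O + Oz`, so a maximal order already contains it
(`IsMaximalQuatOrder.mem_of_integral`). This replaces any localization or local principality of
ideals. If `Is ⊆ O₁d = IJ`, then `nrd(x) s = star x (x s) ∈ Ī I J ⊆ N J` for all `x ∈ I`, hence `N s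
∈ N J` and `s ∈ J`. The same device proves `J = (d / N) Ī` (`IsIntegerIdealDivision.mem_iff`).

For the algorithm, a basis of `J` is the conjugated basis of `I` times `d / N`, so only `N` has to
be found. The determinants of the bases of `I` and `O₁` have quotient `± N²`
(`IsIntegerIdealDivision.abs_det_eq`). That quotient costs boundedly many arithmetic operations, and
a square root then gives `N`. No gcd or lattice reduction occurs, since fractions need not be
reduced.

The square root takes `O(log L)` arithmetic operations on integers of length `O(L)`: powers of two
with Fibonacci exponents locate `N` up to a factor two, and Newton's iteration then converges
quadratically. With multiplication cost `L (1 + log L)²` the total is `L (1 + log L)³` up to a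
constant. -/

/-! ### Reduced norm and trace, and their integrality. -/

section ReducedNorm

variable {a b : ℚ}

/-- The reduced norm of a quaternion. -/
def nrd (x : ℍ[ℚ, a, b]) : ℚ := (x * star x).re

theorem nrd_eq (x : ℍ[ℚ, a, b]) :
    nrd x = x.re ^ 2 - a * x.imI ^ 2 - b * x.imJ ^ 2 + a * b * x.imK ^ 2 := by
  simp [nrd]; ring

theorem mul_star_eq_nrd (x : ℍ[ℚ, a, b]) : x * star x = ((nrd x : ℚ) : ℍ[ℚ, a, b]) :=
  QuaternionAlgebra.mul_star_eq_coe x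

theorem nrd_star (x : ℍ[ℚ, a, b]) : nrd (star x) = nrd x := by
  simp [nrd_eq]

theorem star_mul_eq_nrd (x : ℍ[ℚ, a, b]) : star x * x = ((nrd x : ℚ) : ℍ[ℚ, a, b]) := by
  rw [← nrd_star, ← mul_star_eq_nrd, star_star]

theorem nrd_mul (x y : ℍ[ℚ, a, b]) : nrd (x * y) = nrd x * nrd y := by
  simp [nrd_eq]; ring

theorem nrd_add (x y : ℍ[ℚ, a, b]) :
    nrd (x + y) = nrd x + nrd y + 2 * (x * star y).re := by
  simp [nrd_eq]; ring

theorem nrd_coe (q : ℚ) : nrd (q : ℍ[ℚ, a, b]) = q ^ 2 := by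
  simp [nrd_eq]

/-- An element plus its conjugate is its trace. Applied to `z * u`, this moves `z` to the right of
elements of an order. -/
theorem mul_eq_trace_sub (z u : ℍ[ℚ, a, b]) :
    z * u = ((2 * (z * u).re : ℚ) : ℍ[ℚ, a, b]) - star u * star z := by
  rw [two_mul]
  ext <;> simp <;> ring

theorem star_eq_trace_sub (z : ℍ[ℚ, a, b]) : star z = ((2 * z.re : ℚ) : ℍ[ℚ, a, b]) - z := by
  rw [two_mul]
  ext <;> simp

theorem re_mul_comm (x y : ℍ[ℚ, a, b]) : (x * y).re = (y * x).re := by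
  simp; ring

theorem coe_mul_cancel {q : ℚ} (hq : q ≠ 0) {x y : ℍ[ℚ, a, b]}
    (h : (q : ℍ[ℚ, a, b]) * x = (q : ℍ[ℚ, a, b]) * y) : x = y := by
  rw [QuaternionAlgebra.coe_mul_eq_smul, QuaternionAlgebra.coe_mul_eq_smul] at h
  exact smul_right_injective _ hq h

open Polynomial in
-- A non-scalar `x` has minimal polynomial `X² - tr(x) X + nrd(x)` over `ℚ`. It divides a monic
-- integer polynomial, so Gauss's lemma makes its coefficients integers. Scalars are handled by
-- integral closedness of `ℤ`.
theorem exists_int_trace_nrd_of_isIntegral {x : ℍ[ℚ, a, b]} (hx : IsIntegral ℤ x) :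
    (∃ t : ℤ, 2 * x.re = t) ∧ ∃ n : ℤ, nrd x = n := by
  by_cases hc : ∃ q : ℚ, x = (q : ℍ[ℚ, a, b])
  · obtain ⟨q, rfl⟩ := hc
    have hq : IsIntegral ℤ q := by
      refine (isIntegral_algebraMap_iff (B := ℍ[ℚ, a, b]) ?_).1 hx
      exact QuaternionAlgebra.algebraMap_injective
    obtain ⟨m, hm⟩ := IsIntegrallyClosed.isIntegral_iff.1 hq
    simp only [algebraMap_int_eq, eq_intCast] at hm
    refine ⟨⟨2 * m, ?_⟩, ⟨m ^ 2, ?_⟩⟩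
    · simp [← hm]
    · simp [nrd_coe, ← hm]
  · obtain ⟨p, hp, hpx⟩ := hx
    set f : ℚ[X] := X ^ 2 - C (2 * x.re) * X + C (nrd x) with hf
    have hfm : f.Monic := by rw [hf]; monicity!
    have hfd : f.natDegree = 2 := by rw [hf]; compute_degree!
    have hfx : aeval x f = 0 := by
      have h1 := star_mul_eq_nrd x
      rw [star_eq_trace_sub, sub_mul] at h1
      simp only [hf, map_add, map_sub, map_mul (aeval x), map_pow, aeval_X, aeval_C]
      rw [QuaternionAlgebra.coe_algebraMap, ← h1, pow_two]
      abel
    have hpx' : aeval x (p.map (Int.castRingHom ℚ)) = 0 := by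
      have : aeval x p = 0 := hpx
      rw [← this]
      exact aeval_map_algebraMap (A := ℚ) x p
    have hdvd : f ∣ p.map (Int.castRingHom ℚ) := by
      rw [← modByMonic_eq_zero_iff_dvd hfm]
      have hr : aeval x (p.map (Int.castRingHom ℚ) %ₘ f) = 0 := by
        have h2 := congrArg (aeval x) (modByMonic_add_div (p.map (Int.castRingHom ℚ)) f)
        rw [map_add, map_mul, hfx, zero_mul, add_zero, hpx'] at h2
        exact h2
      have hdeg : (p.map (Int.castRingHom ℚ) %ₘ f).natDegree ≤ 1 := by
        have := natDegree_modByMonic_lt (p.map (Int.castRingHom ℚ)) hfm (by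
          intro h; rw [h] at hfd; simp at hfd)
        omega
      obtain ⟨c, e, hce⟩ := exists_eq_X_add_C_of_natDegree_le_one hdeg
      rw [hce] at hr ⊢
      simp only [map_add, map_mul, aeval_X, aeval_C] at hr
      rw [QuaternionAlgebra.coe_algebraMap] at hr
      -- A nonzero linear coefficient of the remainder would make `x` a scalar.
      have hc0 : c = 0 := by
        by_contra hne
        apply hc
        refine ⟨-(e / c), coe_mul_cancel hne ?_⟩
        rw [eq_neg_of_add_eq_zero_left hr, ← QuaternionAlgebra.coe_mul,
          ← QuaternionAlgebra.coe_neg]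
        congr 1
        field_simp
      subst hc0
      have he : e = 0 := by
        have := congrArg QuaternionAlgebra.re hr
        simpa using this
      simp [he]
    obtain ⟨g, hg⟩ := IsIntegrallyClosed.eq_map_mul_C_of_dvd ℚ hp hdvd
    rw [hfm.leadingCoeff, C_1, mul_one] at hg
    constructor
    · refine ⟨-g.coeff 1, ?_⟩
      have := congrArg (fun h => coeff h 1) hg
      simp [hf] at this
      push_cast
      linarith
    · refine ⟨g.coeff 0, ?_⟩
      have := congrArg (fun h => coeff h 0) hg
      simp [hf] at this
      exact this.symm

end ReducedNorm

/-! ### Full lattices: bases over `ℤ` and over `ℚ`. -/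

section Lattices

variable {a b : ℚ}

instance : Module.IsTorsionFree ℤ ℍ[ℚ, a, b] where
  isSMulRegular n hn x y hxy := by
    have hn : (n : ℚ) ≠ 0 := by exact_mod_cast hn.ne_zero
    simpa [QuaternionAlgebra.ext_iff, hn] using hxy

theorem IsZBasis.linearIndependent_rat {v : Fin 4 → ℍ[ℚ, a, b]} {L : Submodule ℤ ℍ[ℚ, a, b]}
    (hv : IsZBasis v L) : LinearIndependent ℚ v :=
  (LinearIndependent.iff_fractionRing ℤ ℚ).1 hv.1

theorem IsZBasis.span_rat {v : Fin 4 → ℍ[ℚ, a, b]} {L : Submodule ℤ ℍ[ℚ, a, b]}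
    (hv : IsZBasis v L) : Submodule.span ℚ (Set.range v) = ⊤ :=
  hv.linearIndependent_rat.span_eq_top_of_card_eq_finrank'
    (by simp [QuaternionAlgebra.finrank_eq_four])

theorem IsFullLattice.exists_basis {L : Submodule ℤ ℍ[ℚ, a, b]} (hL : IsFullLattice L) :
    ∃ v : Fin 4 → ℍ[ℚ, a, b], IsZBasis v L := by
  have : Module.Finite ℤ L := Module.Finite.iff_fg.2 hL.1
  have : Module.Free ℤ L := inferInstance
  let B := Module.finBasisOfFinrankEq ℤ L hL.2
  refine ⟨fun i => (B i : ℍ[ℚ, a, b]), ?_, ?_⟩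
  · exact B.linearIndependent.map' L.subtype (Submodule.ker_subtype L)
  · have := congrArg (Submodule.map L.subtype) B.span_eq
    rw [Submodule.map_span, ← Set.range_comp, Submodule.map_top, Submodule.range_subtype] at this
    exact this

theorem IsFullLattice.of_le {L L' : Submodule ℤ ℍ[ℚ, a, b]} (hL : IsFullLattice L) (hLL : L ≤ L')
    (hfg : L'.FG) : IsFullLattice L' := by
  refine ⟨hfg, le_antisymm ?_ ?_⟩
  · have : Module.Finite ℤ L' := Module.Finite.iff_fg.2 hfg
    have : Module.Free ℤ L' := inferInstance
    let B := Module.finBasis ℤ L'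
    have h1 : LinearIndependent ℤ fun i => (B i : ℍ[ℚ, a, b]) :=
      B.linearIndependent.map' L'.subtype (Submodule.ker_subtype L')
    have h2 := ((LinearIndependent.iff_fractionRing ℤ ℚ).1 h1).fintype_card_le_finrank
    simpa [QuaternionAlgebra.finrank_eq_four] using h2
  · have : Module.Finite ℤ L' := Module.Finite.iff_fg.2 hfg
    rw [← hL.2]
    exact Submodule.finrank_mono hLL

/-- The lattice spans the algebra over `ℚ`; clear the denominators in the expansion of `1`. -/
theorem IsFullLattice.exists_int_mem {L : Submodule ℤ ℍ[ℚ, a, b]} (hL : IsFullLattice L) :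
    ∃ n : ℤ, n ≠ 0 ∧ (n : ℍ[ℚ, a, b]) ∈ L := by
  obtain ⟨v, hv⟩ := hL.exists_basis
  have h1 : (1 : ℍ[ℚ, a, b]) ∈ Submodule.span ℚ (Set.range v) := by rw [hv.span_rat]; trivial
  obtain ⟨c, hc⟩ := (Submodule.mem_span_range_iff_exists_fun ℚ).1 h1
  obtain ⟨n, hn⟩ := IsLocalization.exist_integer_multiples_of_finset (nonZeroDivisors ℤ)
    (Finset.univ.image c)
  refine ⟨n, nonZeroDivisors.ne_zero n.2, ?_⟩
  have h2 : ((n : ℤ) : ℍ[ℚ, a, b]) = ∑ i, ((n : ℤ) : ℚ) • c i • v i := by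
    rw [← Finset.smul_sum, hc]
    ext <;> simp
  rw [h2]
  refine L.sum_mem fun i _ => ?_
  obtain ⟨k, hk⟩ := hn (c i) (by simp)
  have h3 : ((n : ℤ) : ℚ) • c i • v i = k • v i := by
    rw [smul_smul]
    simp only [algebraMap_int_eq, eq_intCast, zsmul_eq_mul] at hk
    rw [← hk]
    ext <;> simp
  rw [h3]
  refine L.smul_mem k ?_
  rw [← hv.2]
  exact Submodule.subset_span ⟨i, rfl⟩

end Lattices

/-! ### Maximal orders and the norm of a lattice. -/

section MaximalOrders

variable {a b : ℚ}

theorem IsQuatOrder.trace_nrd {O : Subalgebra ℤ ℍ[ℚ, a, b]} (hO : IsQuatOrder O)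
    {x : ℍ[ℚ, a, b]} (hx : x ∈ O) : (∃ t : ℤ, 2 * x.re = t) ∧ ∃ n : ℤ, nrd x = n :=
  exists_int_trace_nrd_of_isIntegral (IsIntegral.of_mem_of_fg O hO.1 x hx)

theorem int_mem_subalgebra (O : Subalgebra ℤ ℍ[ℚ, a, b]) (n : ℤ) : (n : ℍ[ℚ, a, b]) ∈ O :=
  intCast_mem O n

theorem IsQuatOrder.star_mem {O : Subalgebra ℤ ℍ[ℚ, a, b]} (hO : IsQuatOrder O)
    {x : ℍ[ℚ, a, b]} (hx : x ∈ O) : star x ∈ O := by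
  obtain ⟨⟨t, ht⟩, -⟩ := hO.trace_nrd hx
  rw [star_eq_trace_sub, ht, QuaternionAlgebra.coe_intCast]
  exact O.sub_mem (int_mem_subalgebra O t) hx

/-- This is `zO ⊆ O + Oz`, from `zu = tr(zu) - ū z̄` and `z̄ = tr(z) - z`. It is half of what makes
`O + Oz` a ring. -/
theorem mul_mem_add_mul {O : Subalgebra ℤ ℍ[ℚ, a, b]} (hO : IsQuatOrder O) {z : ℍ[ℚ, a, b]}
    (ht : ∀ o ∈ O, ∃ t : ℤ, 2 * (z * o).re = t) {u : ℍ[ℚ, a, b]} (hu : u ∈ O) :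
    ∃ v ∈ O, ∃ w ∈ O, z * u = v + w * z := by
  obtain ⟨t, htu⟩ := ht u hu
  obtain ⟨s, hs⟩ := ht 1 O.one_mem
  rw [mul_one] at hs
  refine ⟨(t : ℍ[ℚ, a, b]) - star u * (s : ℍ[ℚ, a, b]), ?_, star u, hO.star_mem hu, ?_⟩
  · exact O.sub_mem (int_mem_subalgebra O t) (O.mul_mem (hO.star_mem hu) (int_mem_subalgebra O s))
  · rw [mul_eq_trace_sub, htu, star_eq_trace_sub z, hs, QuaternionAlgebra.coe_intCast,
      QuaternionAlgebra.coe_intCast]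
    noncomm_ring

/-- The order `O + Oz`. -/
def adjoinElement (O : Subalgebra ℤ ℍ[ℚ, a, b]) (hO : IsQuatOrder O) (z : ℍ[ℚ, a, b])
    (ht : ∀ o ∈ O, ∃ t : ℤ, 2 * (z * o).re = t) (hn : ∃ n : ℤ, nrd z = n) :
    Subalgebra ℤ ℍ[ℚ, a, b] where
  carrier := {x | ∃ u ∈ O, ∃ v ∈ O, x = u + v * z}
  add_mem' := by
    rintro _ _ ⟨u, hu, v, hv, rfl⟩ ⟨u', hu', v', hv', rfl⟩
    exact ⟨u + u', O.add_mem hu hu', v + v', O.add_mem hv hv', by noncomm_ring⟩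
  mul_mem' := by
    rintro _ _ ⟨u, hu, v, hv, rfl⟩ ⟨u', hu', v', hv', rfl⟩
    obtain ⟨n, hn⟩ := hn
    obtain ⟨p, hp, q, hq, h1⟩ := mul_mem_add_mul hO ht hu'
    obtain ⟨t, htv⟩ := ht v' hv'
    -- The other half: `z v' z = (tr(z v') - star v' * star z) z`, and `star z * z` is the integer
    -- `nrd z`.
    have h2 : z * v' * z = (t : ℍ[ℚ, a, b]) * z - star v' * (n : ℍ[ℚ, a, b]) := by
      rw [mul_eq_trace_sub z v', htv, sub_mul, mul_assoc, star_mul_eq_nrd, hn,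
        QuaternionAlgebra.coe_intCast, QuaternionAlgebra.coe_intCast]
    refine ⟨u * u' + v * p - v * (star v' * (n : ℍ[ℚ, a, b])), ?_,
      u * v' + v * q + v * (t : ℍ[ℚ, a, b]), ?_, ?_⟩
    · exact O.sub_mem (O.add_mem (O.mul_mem hu hu') (O.mul_mem hv hp))
        (O.mul_mem hv (O.mul_mem (hO.star_mem hv') (int_mem_subalgebra O n)))
    · exact O.add_mem (O.add_mem (O.mul_mem hu hv') (O.mul_mem hv hq))
        (O.mul_mem hv (int_mem_subalgebra O t))
    · calc (u + v * z) * (u' + v' * z)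
          = u * u' + u * v' * z + v * (z * u') + v * (z * v' * z) := by noncomm_ring
        _ = _ := by rw [h1, h2]; noncomm_ring
  algebraMap_mem' r := ⟨_, O.algebraMap_mem r, 0, O.zero_mem, by simp⟩

/-- A quaternion of integral norm with integral traces against a maximal order lies in it. -/
theorem IsMaximalQuatOrder.mem_of_integral {O : Subalgebra ℤ ℍ[ℚ, a, b]}
    (hO : IsMaximalQuatOrder O) {z : ℍ[ℚ, a, b]}
    (ht : ∀ o ∈ O, ∃ t : ℤ, 2 * (o * z).re = t) (hn : ∃ n : ℤ, nrd z = n) : z ∈ O := by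
  have ht' : ∀ o ∈ O, ∃ t : ℤ, 2 * (z * o).re = t := fun o ho => by
    rw [re_mul_comm]; exact ht o ho
  set O' := adjoinElement O hO.1 z ht' hn with hO'
  have hle : O ≤ O' := fun x hx => ⟨x, hx, 0, O.zero_mem, by simp⟩
  have heq : Subalgebra.toSubmodule O' = Subalgebra.toSubmodule O ⊔
      (Subalgebra.toSubmodule O).map (LinearMap.mulRight ℤ z) := by
    ext x
    rw [Submodule.mem_sup]
    constructor
    · rintro ⟨u, hu, v, hv, rfl⟩
      exact ⟨u, hu, v * z, ⟨v, hv, rfl⟩, rfl⟩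
    · rintro ⟨u, hu, _, ⟨v, hv, rfl⟩, rfl⟩
      exact ⟨u, hu, v, hv, rfl⟩
  -- `O + Oz` is finitely generated and contains the full lattice `O`, so maximality forces `O + Oz
  -- = O`.
  have hord : IsQuatOrder O' := by
    refine IsFullLattice.of_le hO.1 (L := Subalgebra.toSubmodule O) hle ?_
    rw [heq]
    exact hO.1.1.sup (hO.1.1.map _)
  rw [← hO.2 O' hord hle]
  exact ⟨0, O.zero_mem, 1, O.one_mem, by simp⟩

/-- Polarizing the norm shows that `tr(y x̄)` is divisible by `N`. With `oy` in place of `y`, the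
quotient `y x̄ / N` has integral traces against `O`; its norm `nrd(x) nrd(y) / N²` is integral too.
Taking `I` to be a mere set allows the use of the set of conjugates of an ideal. -/
theorem IsMaximalQuatOrder.mul_star_mem {O : Subalgebra ℤ ℍ[ℚ, a, b]}
    (hO : IsMaximalQuatOrder O) {I : Set ℍ[ℚ, a, b]} (hadd : ∀ x ∈ I, ∀ y ∈ I, x + y ∈ I)
    (hI : ∀ o ∈ O, ∀ x ∈ I, o * x ∈ I) {N : ℤ} (hN : N ≠ 0)
    (hnrd : ∀ x ∈ I, ∃ k : ℤ, nrd x = N * k) {x y : ℍ[ℚ, a, b]} (hx : x ∈ I) (hy : y ∈ I) :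
    ∃ o ∈ O, y * star x = (N : ℍ[ℚ, a, b]) * o := by
  have hNq : (N : ℚ) ≠ 0 := by exact_mod_cast hN
  have htr : ∀ y ∈ I, ∃ t : ℤ, 2 * (y * star x).re = N * t := fun y hy => by
    obtain ⟨k, hk⟩ := hnrd _ (hadd y hy x hx)
    obtain ⟨m, hm⟩ := hnrd _ hy
    obtain ⟨n, hn⟩ := hnrd _ hx
    rw [nrd_add] at hk
    exact ⟨k - m - n, by push_cast; linarith⟩
  refine ⟨((1 / N : ℚ) : ℍ[ℚ, a, b]) * (y * star x), hO.mem_of_integral ?_ ?_, ?_⟩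
  · intro o ho
    obtain ⟨t, ht⟩ := htr _ (hI o ho y hy)
    refine ⟨t, ?_⟩
    rw [← mul_assoc, ← QuaternionAlgebra.coe_commutes, mul_assoc, ← mul_assoc o,
      QuaternionAlgebra.coe_mul_eq_smul, QuaternionAlgebra.re_smul, smul_eq_mul]
    field_simp
    linarith
  · obtain ⟨m, hm⟩ := hnrd _ hy
    obtain ⟨n, hn⟩ := hnrd _ hx
    refine ⟨m * n, ?_⟩
    rw [nrd_mul, nrd_mul, nrd_star, nrd_coe, hm, hn]
    push_cast
    field_simp
  · rw [← mul_assoc, ← QuaternionAlgebra.coe_intCast, ← QuaternionAlgebra.coe_mul]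
    have : (N : ℚ) * (1 / N) = 1 := by field_simp
    rw [this, QuaternionAlgebra.coe_one, one_mul]

/-- `N` is the reduced norm of the lattice `I`. -/
structure IsLatticeNorm (I : Submodule ℤ ℍ[ℚ, a, b]) (N : ℕ) : Prop where
  pos : 0 < N
  dvd : ∀ x ∈ I, ∃ k : ℤ, nrd x = N * k
  mem_span : (N : ℚ) ∈ Submodule.span ℤ (nrd '' (I : Set ℍ[ℚ, a, b]))

/-- The norms generate an ideal of `ℤ`. It is nonzero because `I` contains an integer `n ≠ 0`, whose
norm is `n²`. -/
theorem exists_latticeNorm {I : Submodule ℤ ℍ[ℚ, a, b]} (hI : IsFullLattice I)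
    (hint : ∀ x ∈ I, ∃ n : ℤ, nrd x = n) : ∃ N : ℕ, IsLatticeNorm I N := by
  set A : Submodule ℤ ℤ := (Submodule.span ℤ (nrd '' (I : Set ℍ[ℚ, a, b]))).comap
    (Algebra.linearMap ℤ ℚ) with hA
  obtain ⟨g, hg⟩ := (IsPrincipalIdealRing.principal (show Ideal ℤ from A)).principal
  have hmem : ∀ n : ℤ, n ∈ A ↔ ∃ k : ℤ, k * g = n := fun n => by
    have : n ∈ A ↔ n ∈ Submodule.span ℤ {g} := by rw [← hg]
    rw [this, Submodule.mem_span_singleton]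
    rfl
  have hAmem : ∀ n : ℤ, n ∈ A ↔ (n : ℚ) ∈ Submodule.span ℤ (nrd '' (I : Set ℍ[ℚ, a, b])) :=
    fun n => Iff.rfl
  have hg0 : g ≠ 0 := by
    rintro rfl
    obtain ⟨n, hn, hnI⟩ := hI.exists_int_mem
    have : n ^ 2 ∈ A := by
      rw [hAmem]
      refine Submodule.subset_span ⟨_, hnI, ?_⟩
      rw [← QuaternionAlgebra.coe_intCast, nrd_coe]
      push_cast; rfl
    obtain ⟨k, hk⟩ := (hmem _).1 this
    rw [mul_zero] at hk
    exact hn (pow_eq_zero_iff two_ne_zero |>.1 hk.symm)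
  have hNA : (g.natAbs : ℤ) ∈ A := by
    rw [hmem]
    exact ⟨g.sign, by rw [Int.sign_mul_self_eq_abs, Int.abs_eq_natAbs]⟩
  refine ⟨g.natAbs, Int.natAbs_pos.2 hg0, fun x hx => ?_, by simpa using (hAmem _).1 hNA⟩
  obtain ⟨n, hn⟩ := hint x hx
  have : n ∈ A := by
    rw [hAmem, ← hn]
    exact Submodule.subset_span ⟨x, hx, rfl⟩
  obtain ⟨k, hk⟩ := (hmem _).1 this
  obtain ⟨e, he⟩ : (g.natAbs : ℤ) ∣ n := Int.natAbs_dvd.2 ⟨k, by rw [← hk, mul_comm]⟩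
  refine ⟨e, ?_⟩
  rw [hn, he, Int.cast_mul, Int.cast_natCast]

/-- To bound `N s` it suffices to bound `nrd(x) s` for `x ∈ I`. -/
theorem IsLatticeNorm.mul_mem {I M : Submodule ℤ ℍ[ℚ, a, b]} {N : ℕ} (hN : IsLatticeNorm I N)
    {s : ℍ[ℚ, a, b]} (h : ∀ x ∈ I, ((nrd x : ℚ) : ℍ[ℚ, a, b]) * s ∈ M) :
    (N : ℍ[ℚ, a, b]) * s ∈ M := by
  have key : ∀ q ∈ Submodule.span ℤ (nrd '' (I : Set ℍ[ℚ, a, b])), (q : ℍ[ℚ, a, b]) * s ∈ M := by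
    intro q hq
    induction hq using Submodule.span_induction with
    | mem q hq => obtain ⟨x, hx, rfl⟩ := hq; exact h x hx
    | zero => simp
    | add p q _ _ hp hq => rw [QuaternionAlgebra.coe_add, add_mul]; exact M.add_mem hp hq
    | smul n q _ hq =>
      have : ((n • q : ℚ) : ℍ[ℚ, a, b]) * s = n • ((q : ℍ[ℚ, a, b]) * s) := by
        ext <;> simp <;> ring
      rw [this]; exact M.smul_mem n hq
  have := key _ hN.mem_span
  rwa [QuaternionAlgebra.coe_natCast] at this

end MaximalOrders

/-! ### The formula for `J`. -/

section Division

variable {a b : ℚ} {O₁ O₂ : Subalgebra ℤ ℍ[ℚ, a, b]} {I J : Submodule ℤ ℍ[ℚ, a, b]} {d : ℤ}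

theorem mem_principalLeftIdeal {O : Subalgebra ℤ ℍ[ℚ, a, b]} {μ x : ℍ[ℚ, a, b]} :
    x ∈ principalLeftIdeal O μ ↔ ∃ o ∈ O, o * μ = x := Iff.rfl

namespace IsConnectingIdeal

theorem left_mul_mem (h : IsConnectingIdeal O₁ O₂ I) {o x : ℍ[ℚ, a, b]} (ho : o ∈ O₁)
    (hx : x ∈ I) : o * x ∈ I := by
  have : o ∈ leftOrder I := by rw [h.left_eq]; exact ho
  exact this x hx

theorem right_mul_mem (h : IsConnectingIdeal O₁ O₂ I) {o x : ℍ[ℚ, a, b]} (ho : o ∈ O₂)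
    (hx : x ∈ I) : x * o ∈ I := by
  have : o ∈ rightOrder I := by rw [h.right_eq]; exact ho
  exact this x hx

theorem le_left (h : IsConnectingIdeal O₁ O₂ I) {x : ℍ[ℚ, a, b]} (hx : x ∈ I) : x ∈ O₁ := by
  have := h.integral hx
  rwa [h.left_eq] at this

end IsConnectingIdeal

namespace IsIntegerIdealDivision

theorem mul_mem_principal (h : IsIntegerIdealDivision O₁ O₂ I J d) {x s : ℍ[ℚ, a, b]} (hx : x ∈ I)
    (hs : s ∈ J) : x * s ∈ principalLeftIdeal O₁ (d : ℍ[ℚ, a, b]) := by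
  rw [h.factor]; exact Submodule.mul_mem_mul hx hs

theorem ne_zero (h : IsIntegerIdealDivision O₁ O₂ I J d) : d ≠ 0 := by
  rintro rfl
  obtain ⟨m, hm, hmI⟩ := h.connecting.lattice.exists_int_mem
  obtain ⟨n, hn, hnJ⟩ := h.left_ideal.lattice.exists_int_mem
  obtain ⟨o, -, ho⟩ := mem_principalLeftIdeal.1 (h.mul_mem_principal hmI hnJ)
  have := congrArg QuaternionAlgebra.re ho
  simp at this
  tauto

theorem exists_norm (h : IsIntegerIdealDivision O₁ O₂ I J d) : ∃ N : ℕ, IsLatticeNorm I N :=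
  exists_latticeNorm h.connecting.lattice fun _ hx =>
    (h.maximal₁.1.trace_nrd (h.connecting.le_left hx)).2

/-- The conjugate of `I` is a left `O₂`-module with the same norms, so the result for left modules
over a maximal order applies to it. -/
theorem star_mul_mem (h : IsIntegerIdealDivision O₁ O₂ I J d) {N : ℕ} (hN : IsLatticeNorm I N)
    {x y : ℍ[ℚ, a, b]} (hx : x ∈ I) (hy : y ∈ I) :
    ∃ o ∈ O₂, star x * y = (N : ℍ[ℚ, a, b]) * o := by
  obtain ⟨o, ho, h1⟩ := h.maximal₂.mul_star_mem (I := {z | star z ∈ I}) (N := N)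
    (fun x hx y hy => by
      simp only [Set.mem_ofPred_eq, star_add] at *
      exact I.add_mem hx hy)
    (fun o ho x hx => by
      simp only [Set.mem_ofPred_eq, star_mul] at *
      exact h.connecting.right_mul_mem (h.maximal₂.1.star_mem ho) hx)
    (by exact_mod_cast hN.pos.ne')
    (fun x hx => by
      obtain ⟨k, hk⟩ := hN.dvd _ hx
      exact ⟨k, by rw [← nrd_star, hk]; rfl⟩)
    (x := star y) (y := star x) (by simpa using hy) (by simpa using hx)
  rw [star_star] at h1
  exact ⟨o, ho, by simpa using h1⟩

theorem mul_star_mem (h : IsIntegerIdealDivision O₁ O₂ I J d) {N : ℕ} (hN : IsLatticeNorm I N)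
    {x y : ℍ[ℚ, a, b]} (hx : x ∈ I) (hy : y ∈ I) :
    ∃ o ∈ O₁, y * star x = (N : ℍ[ℚ, a, b]) * o := by
  obtain ⟨o, ho, h1⟩ := h.maximal₁.mul_star_mem (I := (I : Set ℍ[ℚ, a, b])) (N := N)
    (fun x hx y hy => I.add_mem hx hy)
    (fun o ho x hx => h.connecting.left_mul_mem ho hx)
    (by exact_mod_cast hN.pos.ne')
    (fun x hx => by
      obtain ⟨k, hk⟩ := hN.dvd _ hx
      exact ⟨k, by rw [hk]; rfl⟩) hx hy
  exact ⟨o, ho, by simpa using h1⟩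

/-- For `x ∈ I`, `nrd(x) s = x̄ (x s)` lies in `x̄ I J ⊆ N O₂ J = N J`. Since the norms span `N`,
also `N s ∈ N J`. -/
theorem mem_of_mul_mem (h : IsIntegerIdealDivision O₁ O₂ I J d) {s : ℍ[ℚ, a, b]}
    (hs : ∀ x ∈ I, x * s ∈ principalLeftIdeal O₁ (d : ℍ[ℚ, a, b])) : s ∈ J := by
  obtain ⟨N, hN⟩ := h.exists_norm
  have hN0 : (N : ℚ) ≠ 0 := by exact_mod_cast hN.pos.ne'
  have h1 : (N : ℍ[ℚ, a, b]) * s ∈ J.map (LinearMap.mulLeft ℤ (N : ℍ[ℚ, a, b])) := by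
    refine hN.mul_mem fun x hx => ?_
    rw [← star_mul_eq_nrd, mul_assoc]
    have h2 := hs x hx
    rw [h.factor] at h2
    generalize x * s = w at h2
    induction h2 using Submodule.mul_induction_on' with
    | mem_mul_mem y hy j hj =>
      obtain ⟨o, ho, h3⟩ := h.star_mul_mem hN hx hy
      exact ⟨o * j, h.left_ideal.mul_mem o ho j hj, by
        rw [LinearMap.mulLeft_apply, ← mul_assoc, ← mul_assoc, h3]⟩
    | add y _ z _ hy hz =>
      rw [mul_add]
      exact Submodule.add_mem _ hy hz
  obtain ⟨t, ht, hts⟩ := h1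
  rw [LinearMap.mulLeft_apply, ← QuaternionAlgebra.coe_natCast] at hts
  rw [← coe_mul_cancel hN0 hts]
  exact ht

/-- As `J ⊆ O₂`, `J s ⊆ J`, so right multiplication by `s` preserves `IJ = O₁d`. Applied to `d`
itself this gives `ds ∈ O₁d`, and `d` is central. -/
theorem mem_left_order (h : IsIntegerIdealDivision O₁ O₂ I J d) {s : ℍ[ℚ, a, b]} (hs : s ∈ J) :
    s ∈ O₁ := by
  have hd : (d : ℚ) ≠ 0 := by exact_mod_cast h.ne_zero
  have h1 : (d : ℍ[ℚ, a, b]) ∈ I * J := by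
    rw [← h.factor]
    exact mem_principalLeftIdeal.2 ⟨1, O₁.one_mem, one_mul _⟩
  have h2 : ∀ w ∈ I * J, w * s ∈ I * J := by
    intro w hw
    induction hw using Submodule.mul_induction_on' with
    | mem_mul_mem y hy j hj =>
      rw [mul_assoc]
      exact Submodule.mul_mem_mul hy (h.left_ideal.mul_mem j (h.left_ideal.le_order hj) s hs)
    | add y _ z _ hy hz => rw [add_mul]; exact Submodule.add_mem _ hy hz
  have h3 := h2 _ h1
  rw [← h.factor] at h3
  obtain ⟨o, ho, h4⟩ := mem_principalLeftIdeal.1 h3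
  rw [← QuaternionAlgebra.coe_intCast, ← QuaternionAlgebra.coe_commutes] at h4
  rwa [← coe_mul_cancel hd h4]

theorem coe_eq (h : IsIntegerIdealDivision O₁ O₂ I J d) : (J : Set ℍ[ℚ, a, b]) =
    {s | s ∈ O₁ ∧ s ∈ O₂ ∧ ∀ x ∈ I, x * s ∈ principalLeftIdeal O₁ (d : ℍ[ℚ, a, b])} := by
  ext s
  exact ⟨fun hs => ⟨h.mem_left_order hs, h.left_ideal.le_order hs,
    fun x hx => h.mul_mem_principal hx hs⟩, fun hs => h.mem_of_mul_mem hs.2.2⟩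

/-- `J = (d / N) Ī`, where `N` is the reduced norm of `I`. -/
theorem mem_iff (h : IsIntegerIdealDivision O₁ O₂ I J d) {N : ℕ} (hN : IsLatticeNorm I N)
    {s : ℍ[ℚ, a, b]} : s ∈ J ↔ ∃ x ∈ I, s = ((d : ℚ) / N) • star x := by
  have hN0 : (N : ℚ) ≠ 0 := by exact_mod_cast hN.pos.ne'
  constructor
  · intro hs
    have h1 : (N : ℍ[ℚ, a, b]) * s ∈ 
        (I.map (starAddEquiv (R := ℍ[ℚ, a, b])).toAddMonoidHom.toIntLinearMap).map
          (LinearMap.mulLeft ℤ (d : ℍ[ℚ, a, b])) := by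
      -- With `x s = o d`, one has `nrd(x) s = x̄ o d`, and `x̄ o` is the conjugate of `ō x ∈ I`.
      refine hN.mul_mem fun x hx => ?_
      obtain ⟨o, ho, h2⟩ := mem_principalLeftIdeal.1 (h.mul_mem_principal hx hs)
      refine ⟨star (star o * x), ⟨_, h.connecting.left_mul_mem (h.maximal₁.1.star_mem ho) hx, rfl⟩,
        ?_⟩
      rw [← star_mul_eq_nrd, mul_assoc, ← h2, star_mul, star_star, LinearMap.mulLeft_apply,
        ← QuaternionAlgebra.coe_intCast, QuaternionAlgebra.coe_commutes, mul_assoc]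
    obtain ⟨_, ⟨x, hx, rfl⟩, h3⟩ := h1
    refine ⟨x, hx, coe_mul_cancel hN0 ?_⟩
    rw [QuaternionAlgebra.coe_natCast, ← h3]
    change (d : ℍ[ℚ, a, b]) * star x = _
    ext <;> simp <;> field_simp
  · rintro ⟨x, hx, rfl⟩
    refine h.mem_of_mul_mem fun y hy => mem_principalLeftIdeal.2 ?_
    obtain ⟨o, ho, h1⟩ := h.mul_star_mem hN hx hy
    refine ⟨o, ho, coe_mul_cancel hN0 ?_⟩
    rw [← mul_assoc, QuaternionAlgebra.coe_natCast, ← h1,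
      mul_smul_comm, mul_smul_comm, ← QuaternionAlgebra.coe_natCast,
      QuaternionAlgebra.coe_mul_eq_smul, smul_smul, div_mul_cancel₀ _ hN0,
      ← QuaternionAlgebra.coe_intCast, QuaternionAlgebra.mul_coe_eq_smul]

end IsIntegerIdealDivision

end Division

/-! ### The determinant of a basis of `I` relative to one of `O₁`. -/

section Determinants

variable {a b : ℚ}

/-- The matrix of coordinates of four quaternions. -/
def coordMatrix (v : Fin 4 → ℍ[ℚ, a, b]) : Matrix (Fin 4) (Fin 4) ℚ :=
  Matrix.of fun r => ![(v r).re, (v r).imI, (v r).imJ, (v r).imK]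

theorem coordMatrix_det_ne_zero {v : Fin 4 → ℍ[ℚ, a, b]} {L : Submodule ℤ ℍ[ℚ, a, b]}
    (hv : IsZBasis v L) : (coordMatrix v).det ≠ 0 := by
  have h1 : LinearIndependent ℚ (coordMatrix v).row :=
    hv.linearIndependent_rat.map' (QuaternionAlgebra.linearEquivTuple a 0 b).toLinearMap
      (LinearEquiv.ker _)
  rw [Matrix.linearIndependent_rows_iff_isUnit, Matrix.isUnit_iff_isUnit_det] at h1
  exact h1.ne_zero

theorem exists_coordMatrix_det_eq {v w : Fin 4 → ℍ[ℚ, a, b]} {L : Submodule ℤ ℍ[ℚ, a, b]}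
    (hv : IsZBasis v L) (hw : ∀ r, w r ∈ L) :
    ∃ k : ℤ, (coordMatrix w).det = k * (coordMatrix v).det := by
  have h1 : ∀ r, ∃ c : Fin 4 → ℤ, ∑ i, c i • v i = w r := fun r => by
    have := hw r
    rwa [← hv.2, Submodule.mem_span_range_iff_exists_fun] at this
  choose c hc using h1
  refine ⟨(Matrix.of c).det, ?_⟩
  have h2 : coordMatrix w = (Matrix.of c).map (Int.castRingHom ℚ) * coordMatrix v := by
    ext r s
    rw [Matrix.mul_apply]
    simp only [coordMatrix, Matrix.of_apply, ← hc r, Fin.sum_univ_four]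
    fin_cases s <;> simp
  have h3 := RingHom.map_det (Int.castRingHom ℚ) (Matrix.of c)
  rw [h2, Matrix.det_mul]
  congr 1
  exact h3.symm

/-- Right multiplication by `α` is the linear map whose matrix has the rows `α, iα, jα, ijα`; its
determinant is `nrd(α)²`. -/
theorem coordMatrix_det_mul_right (v : Fin 4 → ℍ[ℚ, a, b]) (α : ℍ[ℚ, a, b]) :
    (coordMatrix fun r => v r * α).det = nrd α ^ 2 * (coordMatrix v).det := by
  have h1 : coordMatrix (fun r => v r * α) = coordMatrix v *
      coordMatrix (a := a) (b := b) ![α, ⟨0, 1, 0, 0⟩ * α, ⟨0, 0, 1, 0⟩ * α, ⟨0, 0, 0, 1⟩ * α] := by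
    ext r s
    rw [Matrix.mul_apply]
    simp only [coordMatrix, Matrix.of_apply, Fin.sum_univ_four]
    fin_cases s <;> simp <;> ring
  rw [h1, Matrix.det_mul, mul_comm]
  congr 1
  rw [Matrix.det_succ_row_zero, nrd_eq]
  simp [Fin.sum_univ_succ, Matrix.det_fin_three, coordMatrix, Fin.succAbove]
  ring

theorem coordMatrix_det_smul (v : Fin 4 → ℍ[ℚ, a, b]) (q : ℚ) :
    (coordMatrix fun r => q • v r).det = q ^ 4 * (coordMatrix v).det := by
  have h1 : coordMatrix (fun r => q • v r) = q • coordMatrix v := by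
    ext r s
    simp only [coordMatrix, Matrix.of_apply, Matrix.smul_apply]
    fin_cases s <;> simp
  rw [h1, Matrix.det_smul, Fintype.card_fin]

theorem IsZBasis.mem {v : Fin 4 → ℍ[ℚ, a, b]} {L : Submodule ℤ ℍ[ℚ, a, b]}
    (hv : IsZBasis v L) (r : Fin 4) : v r ∈ L := by
  rw [← hv.2]
  exact Submodule.subset_span ⟨r, rfl⟩

/-- The index of `I` in its left order is the square of its norm. -/
theorem IsIntegerIdealDivision.abs_det_eq {O₁ O₂ : Subalgebra ℤ ℍ[ℚ, a, b]}
    {I J : Submodule ℤ ℍ[ℚ, a, b]} {d : ℤ} (h : IsIntegerIdealDivision O₁ O₂ I J d) {N : ℕ}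
    (hN : IsLatticeNorm I N) {v w : Fin 4 → ℍ[ℚ, a, b]}
    (hv : IsZBasis v (Subalgebra.toSubmodule O₁)) (hw : IsZBasis w I) :
    (coordMatrix w).det = N ^ 2 * (coordMatrix v).det ∨
      (coordMatrix w).det = -(N ^ 2 * (coordMatrix v).det) := by
  have hN0 : (N : ℚ) ≠ 0 := by exact_mod_cast hN.pos.ne'
  have hv0 := coordMatrix_det_ne_zero hv
  have hw0 := coordMatrix_det_ne_zero hw
  obtain ⟨i, hi⟩ := exists_coordMatrix_det_eq hv fun r => h.connecting.le_left (hw.mem r)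
  have hi0 : (i : ℚ) ≠ 0 := by
    intro h0; rw [h0, zero_mul] at hi; exact hw0 hi
  -- The two divisibilities compare determinants in the inclusions `O₁x ⊆ I` and `I x̄ ⊆ N O₁`.
  have key : ∀ x ∈ I, ∀ r : ℤ, nrd x = N * r → i ∣ N ^ 2 * r ^ 2 ∧ (N : ℤ) ^ 2 ∣ i * r ^ 2 := by
    intro x hx r hr
    obtain ⟨e, he⟩ := exists_coordMatrix_det_eq hw (w := fun r => v r * x)
      fun r => h.connecting.left_mul_mem (hv.mem r) hx
    have hz : ∀ r, ∃ o ∈ O₁, w r * star x = (N : ℍ[ℚ, a, b]) * o :=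
      fun r => h.mul_star_mem hN hx (hw.mem r)
    choose o ho hwo using hz
    obtain ⟨f, hf⟩ := exists_coordMatrix_det_eq hv (w := o) ho
    have hwo' : (fun r => w r * star x) = fun r => (N : ℚ) • o r := by
      funext r
      rw [hwo, ← QuaternionAlgebra.coe_mul_eq_smul, QuaternionAlgebra.coe_natCast]
    rw [coordMatrix_det_mul_right, hr, hi] at he
    have h2 := coordMatrix_det_mul_right w (star x)
    rw [hwo', coordMatrix_det_smul, hf, nrd_star, hr, hi] at h2
    have he' : ((N ^ 2 * r ^ 2 : ℤ) : ℚ) = ((i * e : ℤ) : ℚ) := by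
      apply mul_right_cancel₀ hv0
      push_cast; linarith
    have hf' : ((i * r ^ 2 : ℤ) : ℚ) = (((N : ℤ) ^ 2 * f : ℤ) : ℚ) := by
      apply mul_right_cancel₀ hv0
      apply mul_left_cancel₀ (pow_ne_zero 2 hN0)
      push_cast; linarith
    exact ⟨⟨e, by exact_mod_cast he'⟩, ⟨f, by exact_mod_cast hf'⟩⟩
  have hspan : Ideal.span {r : ℤ | ∃ x ∈ I, nrd x = N * r} = ⊤ := by
    have h3 : ∀ q ∈ Submodule.span ℤ (nrd '' (I : Set ℍ[ℚ, a, b])),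
        ∃ k ∈ Ideal.span {r : ℤ | ∃ x ∈ I, nrd x = N * r}, q = N * k := by
      intro q hq
      induction hq using Submodule.span_induction with
      | mem q hq =>
        obtain ⟨x, hx, rfl⟩ := hq
        obtain ⟨k, hk⟩ := hN.dvd x hx
        exact ⟨k, Ideal.subset_span ⟨x, hx, hk⟩, hk⟩
      | zero => exact ⟨0, Ideal.zero_mem _, by simp⟩
      | add p q _ _ hp hq =>
        obtain ⟨k, hk, rfl⟩ := hp
        obtain ⟨l, hl, rfl⟩ := hq
        exact ⟨k + l, Ideal.add_mem _ hk hl, by push_cast; ring⟩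
      | smul n q _ hq =>
        obtain ⟨l, hl, rfl⟩ := hq
        exact ⟨n * l, Ideal.mul_mem_left _ n hl, by rw [zsmul_eq_mul]; push_cast; ring⟩
    obtain ⟨k, hk, hk1⟩ := h3 _ hN.mem_span
    have hk2 : (k : ℚ) = 1 := by
      apply mul_left_cancel₀ hN0
      rw [← hk1, mul_one]
    have hk3 : k = 1 := by exact_mod_cast hk2
    rw [Ideal.eq_top_iff_one, ← hk3]
    exact hk
  -- The cofactors `r = nrd(x) / N` generate the unit ideal, hence so do their squares; this removes
  -- the factors `r²` from both divisibilities.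
  have hspan2 := Ideal.span_pow_eq_top _ hspan 2
  have main : ∀ m n : ℤ, (∀ x ∈ I, ∀ r : ℤ, nrd x = N * r → m ∣ n * r ^ 2) → m ∣ n := by
    intro m n hmn
    have h4 : Ideal.span ((fun x : ℤ => x ^ 2) '' {r : ℤ | ∃ x ∈ I, nrd x = N * r}) ≤
        Submodule.comap (LinearMap.mulLeft ℤ n) (Ideal.span {m}) := by
      rw [Ideal.span_le]
      rintro _ ⟨r, ⟨x, hx, hr⟩, rfl⟩
      exact Ideal.mem_span_singleton.2 (hmn x hx r hr)
    rw [hspan2] at h4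
    have := h4 (Submodule.mem_top (x := (1 : ℤ)))
    have := Ideal.mem_span_singleton.1 this
    simpa using this
  have h5 : i ∣ (N : ℤ) ^ 2 := main _ _ fun x hx r hr => (key x hx r hr).1
  have h6 : (N : ℤ) ^ 2 ∣ i := main _ _ fun x hx r hr => (key x hx r hr).2
  have h7 := Int.natAbs_eq_natAbs_iff.1 (Int.natAbs_eq_of_dvd_dvd h5 h6)
  rcases h7 with h7 | h7
  · left; rw [hi, h7]; push_cast; ring
  · right; rw [hi, h7]; push_cast; ring

/-- Conjugating and scaling a basis of `I` gives a basis of `J`. -/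
theorem IsIntegerIdealDivision.isZBasis {O₁ O₂ : Subalgebra ℤ ℍ[ℚ, a, b]}
    {I J : Submodule ℤ ℍ[ℚ, a, b]} {d : ℤ} (h : IsIntegerIdealDivision O₁ O₂ I J d) {N : ℕ}
    (hN : IsLatticeNorm I N) {w : Fin 4 → ℍ[ℚ, a, b]} (hw : IsZBasis w I) :
    IsZBasis (fun r => ((d : ℚ) / N) • star (w r)) J := by
  have hN0 : (N : ℚ) ≠ 0 := by exact_mod_cast hN.pos.ne'
  have hd0 : (d : ℚ) ≠ 0 := by exact_mod_cast h.ne_zero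
  let φ : ℍ[ℚ, a, b] →ₗ[ℤ] ℍ[ℚ, a, b] :=
    { toFun := fun x => ((d : ℚ) / N) • star x
      map_add' := fun x y => by rw [star_add, smul_add]
      map_smul' := fun n x => by ext <;> simp <;> exact Or.inl (by ring) }
  have hφ : LinearMap.ker φ = ⊥ := by
    rw [LinearMap.ker_eq_bot]
    intro x y hxy
    exact star_injective (smul_right_injective _ (div_ne_zero hd0 hN0) hxy)
  refine ⟨hw.1.map' φ hφ, ?_⟩
  have h1 : Submodule.span ℤ (Set.range fun r => φ (w r)) = I.map φ := by
    rw [← hw.2, Submodule.map_span, ← Set.range_comp]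
    rfl
  refine h1.trans ?_
  ext s
  rw [h.mem_iff hN]
  exact ⟨fun ⟨x, hx, hs⟩ => ⟨x, hx, hs.symm⟩, fun ⟨x, hx, hs⟩ => ⟨x, hx, hs.symm⟩⟩

end Determinants

namespace LogRAM

/-! ### Lengths of integers and the cost of multiplication. -/

section Cost

theorem one_le_len (z : ℤ) : 1 ≤ len z := le_max_left _ _

theorem len_le_iff {z : ℤ} {n : ℕ} (hn : 1 ≤ n) : len z ≤ n ↔ z.natAbs < 2 ^ n := by
  simp [len, hn, Nat.size_le]

theorem natAbs_lt_two_pow_len (z : ℤ) : z.natAbs < 2 ^ len z :=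
  (len_le_iff (one_le_len z)).1 le_rfl

theorem Op.len_eval_le (o : Op) (x y : ℤ) : len (o.eval x y) ≤ len x + len y := by
  have hx1 := one_le_len x
  have hy1 := one_le_len y
  rw [len_le_iff (by omega), pow_add]
  have hx := natAbs_lt_two_pow_len x
  have hy := natAbs_lt_two_pow_len y
  have hx2 : 2 ≤ 2 ^ len x := le_self_pow₀ one_le_two (by omega)
  have hy2 : 2 ≤ 2 ^ len y := le_self_pow₀ one_le_two (by omega)
  have hadd : 2 ^ len x + 2 ^ len y ≤ 2 ^ len x * 2 ^ len y := by nlinarith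
  cases o with
  | add => exact (Int.natAbs_add_le x y).trans_lt (by omega)
  | sub => exact (Int.natAbs_sub_le x y).trans_lt (by omega)
  | mul =>
    rw [Op.eval, Int.natAbs_mul]
    exact Nat.mul_lt_mul'' hx hy
  | div =>
    have := Int.natAbs_ediv_le_natAbs x y
    rw [Op.eval]
    nlinarith

/-- The cost of multiplying or dividing integers of total length `n`. -/
def mulCost (n : ℕ) : ℕ := n * (1 + Nat.log 2 n) ^ 2

theorem mulCost_mono {m n : ℕ} (h : m ≤ n) : mulCost m ≤ mulCost n := by
  unfold mulCost
  have := Nat.log_mono_right (b := 2) h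
  gcongr

theorem le_mulCost (n : ℕ) : n ≤ mulCost n :=
  Nat.le_mul_of_pos_right _ (by positivity)

theorem Op.cost_le (o : Op) (n : ℕ) : o.cost n ≤ mulCost n := by
  cases o
  · exact le_mulCost n
  · exact le_mulCost n
  · exact le_rfl
  · exact le_rfl

/-- The product form lets a constant factor in the length become a constant factor in the cost. -/
theorem log_mul_le (c L : ℕ) : 1 + Nat.log 2 (c * L) ≤ (2 + Nat.log 2 c) * (1 + Nat.log 2 L) := by
  have hc : c < 2 ^ (Nat.log 2 c + 1) := Nat.lt_pow_succ_log_self one_lt_two c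
  have hL : L < 2 ^ (Nat.log 2 L + 1) := Nat.lt_pow_succ_log_self one_lt_two L
  have h1 : c * L < 2 ^ (Nat.log 2 c + 1 + (Nat.log 2 L + 1)) := by
    rw [pow_add]; exact Nat.mul_lt_mul'' hc hL
  have h2 := Nat.log_lt_of_lt_pow' (b := 2) (by omega) h1
  nlinarith [Nat.zero_le (Nat.log 2 c * Nat.log 2 L)]

theorem mulCost_mul_le (c L : ℕ) :
    mulCost (c * L) ≤ c * (2 + Nat.log 2 c) ^ 2 * mulCost L := by
  calc mulCost (c * L) ≤ (c * L) * ((2 + Nat.log 2 c) * (1 + Nat.log 2 L)) ^ 2 :=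
        Nat.mul_le_mul_left _ (Nat.pow_le_pow_left (log_mul_le c L) 2)
    _ = _ := by unfold mulCost; ring

end Cost

/-! ### Programs without loops, and loops with bounded iteration count. -/

section LoopFree

/-- All registers hold integers of length at most `L`. -/
def Bounded (m : Mem) (L : ℕ) : Prop := ∀ r, len (m r) ≤ L

theorem Bounded.one_le {m : Mem} {L : ℕ} (h : Bounded m L) : 1 ≤ L := (one_le_len _).trans (h 0)

theorem Bounded.mono {m : Mem} {L L' : ℕ} (h : Bounded m L) (hL : L ≤ L') : Bounded m L' :=
  fun r => (h r).trans hL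

/-- A program without loops. -/
def LoopFree : Prog → Prop
  | .skip => True
  | .assign _ _ _ _ => True
  | .seq P Q => LoopFree P ∧ LoopFree Q
  | .ifPos _ P Q => LoopFree P ∧ LoopFree Q
  | .whilePos _ _ => False

/-- The result of a program without loops. -/
def exec : Prog → Mem → Mem
  | .skip, m => m
  | .assign dst op x y, m => Function.update m (dst.addr m) (op.eval (x.val m) (y.val m))
  | .seq P Q, m => exec Q (exec P m)
  | .ifPos x P Q, m => if 0 < x.val m then exec P m else exec Q m
  | .whilePos _ _, m => m

theorem Operand.len_val_le_cost (m : Mem) (x : Operand) : len (x.val m) ≤ x.cost m := by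
  cases x <;> simp [Operand.val, Operand.cost]

theorem Operand.exists_cost_le (x : Operand) :
    ∃ C, ∀ (m : Mem) (L : ℕ), Bounded m L → x.cost m ≤ C * L := by
  cases x with
  | const z => exact ⟨len z, fun m L h => Nat.le_mul_of_pos_right _ h.one_le⟩
  | reg n =>
    refine ⟨len n + 1, fun m L h => ?_⟩
    have h1 : len (n : ℤ) ≤ len (n : ℤ) * L := Nat.le_mul_of_pos_right _ h.one_le
    have h2 := h n
    simp only [Operand.cost, add_mul]
    omega
  | ind n =>
    refine ⟨len n + 2, fun m L h => ?_⟩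
    have h1 : len (n : ℤ) ≤ len (n : ℤ) * L := Nat.le_mul_of_pos_right _ h.one_le
    have h2 := h n
    have h3 := h (m n).toNat
    simp only [Operand.cost, add_mul]
    omega

theorem Dest.exists_cost_le (x : Dest) :
    ∃ C, ∀ (m : Mem) (L : ℕ), Bounded m L → x.cost m ≤ C * L := by
  cases x with
  | reg n => exact ⟨len n, fun m L h => Nat.le_mul_of_pos_right _ h.one_le⟩
  | ind n =>
    refine ⟨len n + 1, fun m L h => ?_⟩
    have h1 : len (n : ℤ) ≤ len (n : ℤ) * L := Nat.le_mul_of_pos_right _ h.one_le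
    have h2 := h n
    simp only [Dest.cost, add_mul]
    omega

/-- A program without loops has quasi-linear cost and increases lengths at most linearly. -/
theorem LoopFree.exists_bound {P : Prog} (hP : LoopFree P) : ∃ C, ∀ (m : Mem) (L : ℕ),
    Bounded m L → Bounded (exec P m) (C * L) ∧
      ∃ t, Runs P m (exec P m) t ∧ t ≤ C * mulCost L := by
  induction P with
  | skip =>
    refine ⟨1, fun m L h => ⟨by simpa [exec] using h, 1, Runs.skip m, ?_⟩⟩
    have := le_mulCost L
    have := h.one_le
    omega
  | assign dst op x y =>
    obtain ⟨c, hc⟩ := dst.exists_cost_le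
    obtain ⟨k, hk⟩ := x.exists_cost_le
    obtain ⟨l, hl⟩ := y.exists_cost_le
    refine ⟨c + (k + l) * (2 + Nat.log 2 (k + l)) ^ 2 + (k + l) + 1, fun m L h => ⟨?_, _,
      Runs.assign m dst op x y, ?_⟩⟩
    · have h1 : len (op.eval (x.val m) (y.val m)) ≤ (k + l) * L := by
        have h2 := op.len_eval_le (x.val m) (y.val m)
        have h3 := x.len_val_le_cost m
        have h4 := y.len_val_le_cost m
        have h5 := hk m L h
        have h6 := hl m L h
        rw [add_mul]
        omega
      intro r
      simp only [exec, Function.update_apply]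
      split_ifs
      · exact h1.trans (Nat.mul_le_mul_right _ (by omega))
      · exact (h r).trans (Nat.le_mul_of_pos_left _ (by omega))
    · have h1 := (op.cost_le (x.cost m + y.cost m)).trans (mulCost_mono (n := (k + l) * L) (by
        have h5 := hk m L h
        have h6 := hl m L h
        rw [add_mul]
        omega))
      have h2 := mulCost_mul_le (k + l) L
      have h3 : c * L ≤ c * mulCost L := Nat.mul_le_mul_left _ (le_mulCost L)
      have h4 := hc m L h
      simp only [add_mul] at h1 h2 ⊢
      omega
  | seq P Q ihP ihQ =>
    obtain ⟨c, hc⟩ := ihP hP.1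
    obtain ⟨k, hk⟩ := ihQ hP.2
    -- `Q` starts on lengths up to `c * L`, so its cost bound is `k * mulCost (c * L)`.
    refine ⟨c + k * (c * (2 + Nat.log 2 c) ^ 2) + k * c, fun m L h => ?_⟩
    obtain ⟨h1, s, hs, hs'⟩ := hc m L h
    obtain ⟨h2, t, ht, ht'⟩ := hk _ _ h1
    refine ⟨h2.mono ?_, _, Runs.seq hs ht, ?_⟩
    · rw [← mul_assoc]
      exact Nat.mul_le_mul_right _ (by omega)
    · have h3 := Nat.mul_le_mul_left k (mulCost_mul_le c L)
      rw [← mul_assoc] at h3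
      simp only [add_mul]
      omega
  | ifPos x P Q ihP ihQ =>
    obtain ⟨l, hl⟩ := x.exists_cost_le
    obtain ⟨c, hc⟩ := ihP hP.1
    obtain ⟨k, hk⟩ := ihQ hP.2
    refine ⟨l + c + k, fun m L h => ?_⟩
    obtain ⟨h1, s, hs, hs'⟩ := hc m L h
    obtain ⟨h2, t, ht, ht'⟩ := hk m L h
    have h3 := hl m L h
    have h4 : l * L ≤ l * mulCost L := Nat.mul_le_mul_left _ (le_mulCost L)
    by_cases hx : 0 < x.val m
    · simp only [exec, if_pos hx]
      refine ⟨h1.mono (Nat.mul_le_mul_right _ (by omega)), _, Runs.ifPos_true hx hs, ?_⟩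
      simp only [add_mul]; omega
    · simp only [exec, if_neg hx]
      refine ⟨h2.mono (Nat.mul_le_mul_right _ (by omega)), _, Runs.ifPos_false hx ht, ?_⟩
      simp only [add_mul]; omega
  | whilePos x P _ => exact hP.elim

/-- The cost of a loop with an invariant that bounds the number of iterations. -/
theorem exists_runs_whilePos {x : Operand} {P : Prog} (S : ℕ → Mem → Prop) (K : ℕ)
    (hcost : ∀ k m, S k m → x.cost m ≤ K)
    (hstep : ∀ k m, S k m → 0 < x.val m →
      ∃ k', k = k' + 1 ∧ ∃ m' t, Runs P m m' t ∧ t ≤ K ∧ S k' m')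
    (k : ℕ) (m : Mem) (h : S k m) :
    -- `k` bounds the iterations left: each costs a test and a body, and one failing test ends the
    -- loop.
    ∃ k' m' t, Runs (.whilePos x P) m m' t ∧ S k' m' ∧ ¬ 0 < x.val m' ∧ t ≤ (2 * k + 1) * K := by
  induction k generalizing m with
  | zero =>
    refine ⟨0, m, _, Runs.while_false ?_, h, ?_, by simpa using hcost 0 m h⟩
    all_goals
      intro hx
      obtain ⟨k', hk', -⟩ := hstep 0 m h hx
      omega
  | succ k ih =>
    by_cases hx : 0 < x.val m
    · obtain ⟨k', hk', m', s, hs, hsK, hS⟩ := hstep _ m h hx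
      obtain rfl : k = k' := by omega
      obtain ⟨l, m'', t, ht, hS', hx', htK⟩ := ih m' hS
      refine ⟨l, m'', _, Runs.while_true hx hs ht, hS', hx', ?_⟩
      have := hcost _ m h
      have h2 : (2 * (k + 1) + 1) * K = (2 * k + 1) * K + K + K := by ring
      omega
    · refine ⟨_, m, _, Runs.while_false hx, h, hx, (hcost _ m h).trans ?_⟩
      exact Nat.le_mul_of_pos_left _ (by omega)

end LoopFree

/-! ### Compiling arithmetic expressions. -/

section Expressions

/-- Arithmetic expressions in the registers. -/
inductive Expr : Type
  | const (z : ℤ)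
  | reg (n : ℕ)
  | op (o : Op) (e f : Expr)

namespace Expr

/-- The value of an expression. -/
def eval (m : Mem) : Expr → ℤ
  | .const z => z
  | .reg n => m n
  | .op o e f => o.eval (e.eval m) (f.eval m)

/-- All registers of the expression satisfy `p`. -/
def Reads (p : ℕ → Prop) : Expr → Prop
  | .const _ => True
  | .reg n => p n
  | .op _ e f => e.Reads p ∧ f.Reads p

/-- The program that computes an expression into register `t`, with the registers from `t` on as a
stack. -/
def compile : Expr → ℕ → Prog
  | .const z, t => .assign (.reg t) .add (.const z) (.const 0)
  | .reg n, t => .assign (.reg t) .add (.reg n) (.const 0)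
  | .op o e f, t =>
    .seq (e.compile t) (.seq (f.compile (t + 1)) (.assign (.reg t) o (.reg t) (.reg (t + 1))))

theorem eval_congr {p : ℕ → Prop} {m m' : Mem} (h : ∀ r, p r → m r = m' r) {e : Expr}
    (he : e.Reads p) : e.eval m = e.eval m' := by
  induction e with
  | const z => rfl
  | reg n => exact h n he
  | op o e f ihe ihf => simp only [eval, ihe he.1, ihf he.2]

theorem Reads.mono {p q : ℕ → Prop} (h : ∀ r, p r → q r) {e : Expr} (he : e.Reads p) :
    e.Reads q := by
  induction e with
  | const z => trivial
  | reg n => exact h n he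
  | op o e f ihe ihf => exact ⟨ihe he.1, ihf he.2⟩

theorem loopFree_compile (e : Expr) (t : ℕ) : LoopFree (e.compile t) := by
  induction e generalizing t with
  | const z => trivial
  | reg n => trivial
  | op o e f ihe ihf => exact ⟨ihe t, ihf (t + 1), trivial⟩

theorem exec_compile {e : Expr} {t : ℕ} (he : e.Reads (· < t)) (m : Mem) :
    exec (e.compile t) m t = e.eval m ∧ ∀ r < t, exec (e.compile t) m r = m r := by
  induction e generalizing t m with
  | const z =>
    simp only [compile, exec, Dest.addr, Function.update_apply]
    exact ⟨by simp [Op.eval, Operand.val, eval], fun r hr => if_neg hr.ne⟩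
  | reg n =>
    simp only [compile, exec, Dest.addr, Function.update_apply]
    exact ⟨by simp [Op.eval, Operand.val, eval], fun r hr => if_neg hr.ne⟩
  | op o e f ihe ihf =>
    obtain ⟨h1, h2⟩ := ihe he.1 m
    obtain ⟨h3, h4⟩ := ihf (he.2.mono fun r hr => Nat.lt_succ_of_lt hr) (exec (e.compile t) m)
    simp only [compile, exec, Dest.addr, Function.update_apply]
    refine ⟨?_, fun r hr => ?_⟩
    · rw [if_true]
      simp only [Operand.val, eval]
      rw [h4 t (Nat.lt_succ_self t), h1, h3, eval_congr h2 he.2]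
    · rw [if_neg hr.ne, h4 r (by omega), h2 r hr]

end Expr

/-- The program that stores the values of `E 0, …, E (n - 1)` in the registers `0, …, n - 1`. -/
def storeAll (E : ℕ → Expr) (t : ℕ) : ℕ → Prog
  | 0 => .skip
  | n + 1 => .seq (storeAll E t n)
      (.seq ((E n).compile t) (.assign (.reg n) .add (.reg t) (.const 0)))

theorem loopFree_storeAll (E : ℕ → Expr) (t n : ℕ) : LoopFree (storeAll E t n) := by
  induction n with
  | zero => trivial
  | succ n ih => exact ⟨ih, (E n).loopFree_compile t, trivial⟩

/-- The expressions read only registers from `s ≥ n` up to `t`, so neither earlier results nor the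
stack disturb them. -/
theorem exec_storeAll {E : ℕ → Expr} {s t n : ℕ} (hns : n ≤ s)
    (hE : ∀ k < n, (E k).Reads fun r => s ≤ r ∧ r < t) (m : Mem) :
    ∀ r < t, exec (storeAll E t n) m r = if r < n then (E r).eval m else m r := by
  induction n with
  | zero => intro r _; simp [storeAll, exec]
  | succ n ih =>
    intro r hr
    have ih' := ih (by omega) fun k hk => hE k (by omega)
    obtain ⟨h1, h2⟩ := Expr.exec_compile ((hE n (by omega)).mono fun r hr => hr.2)
      (exec (storeAll E t n) m)
    simp only [storeAll, exec, Dest.addr, Function.update_apply]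
    split_ifs with h3 h4 h4
    · subst h3
      simp only [Op.eval, Operand.val, add_zero]
      rw [h1]
      refine Expr.eval_congr (fun k hk => ?_) (hE r (by omega))
      rw [ih' k hk.2, if_neg (by omega)]
    · omega
    · rw [h2 r hr, ih' r hr, if_pos (by omega)]
    · rw [h2 r hr, ih' r hr, if_neg (by omega)]

end Expressions

end LogRAM

namespace LogRAM

/-! ### Integer square root: the program and its single steps. -/

section SquareRoot

/-- The memory `m` with the registers `98` to `102` replaced. -/
def withRegs (m : Mem) (p q i x f : ℤ) : Mem := fun r =>
  if r = 98 then p else if r = 99 then q else if r = 100 then i else if r = 101 then x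
    else if r = 102 then f else m r

theorem withRegs_eq {m : Mem} {r : ℕ} (h : r < 98 ∨ 102 < r) (p q i x f : ℤ) :
    withRegs m p q i x f r = m r := by
  simp only [withRegs]
  repeat rw [if_neg (by omega)]

theorem bounded_withRegs {m : Mem} {L : ℕ} {p q i x f : ℤ} (h : Bounded m L) (hp : len p ≤ L)
    (hq : len q ≤ L) (hi : len i ≤ L) (hx : len x ≤ L) (hf : len f ≤ L) :
    Bounded (withRegs m p q i x f) L := by
  intro r
  have := h r
  simp only [withRegs]
  split_ifs <;> assumption

/-- Sequential composition of a list of programs. -/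
def block : List Prog → Prog
  | [] => .skip
  | P :: l => .seq P (block l)

/-- Initialization of the registers `98` to `102`. -/
def sqrtInit : Prog := block [
  .assign (.reg 98) .add (.const 1) (.const 0),
  .assign (.reg 99) .add (.const 2) (.const 0),
  .assign (.reg 100) .add (.const 0) (.const 0),
  .assign (.reg 101) .add (.const 1) (.const 0),
  .assign (.reg 102) .sub (.reg 97) (.const 3)]

/-- Replace the powers `p`, `q` of two by `q`, `pq`. -/
def sqrtUp : Prog := block [
  .assign (.reg 102) .mul (.reg 98) (.reg 99),
  .assign (.reg 98) .add (.reg 99) (.const 0),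
  .assign (.reg 99) .add (.reg 102) (.const 0),
  .assign (.reg 100) .add (.reg 100) (.const 1),
  .assign (.reg 102) .mul (.reg 99) (.reg 99),
  .assign (.reg 102) .sub (.reg 97) (.reg 102),
  .assign (.reg 102) .add (.reg 102) (.const 1)]

/-- Multiply `x` by `p` if register `102` is positive. -/
def sqrtSelect : Prog :=
  .ifPos (.reg 102) (.assign (.reg 101) .mul (.reg 101) (.reg 98)) .skip

/-- Replace `p`, `q` by `q / p`, `p`, and multiply `x` by `p` if the square of the result is at
most `n`. -/
def sqrtDown : Prog := block [
  .assign (.reg 102) .mul (.reg 101) (.reg 98),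
  .assign (.reg 102) .mul (.reg 102) (.reg 102),
  .assign (.reg 102) .sub (.reg 97) (.reg 102),
  .assign (.reg 102) .add (.reg 102) (.const 1),
  sqrtSelect,
  .assign (.reg 102) .div (.reg 99) (.reg 98),
  .assign (.reg 99) .add (.reg 98) (.const 0),
  .assign (.reg 98) .add (.reg 102) (.const 0),
  .assign (.reg 100) .sub (.reg 100) (.const 1),
  .assign (.reg 102) .add (.const 0) (.const 0)]

/-- Double `x`. -/
def sqrtDouble : Prog := block [
  .assign (.reg 101) .add (.reg 101) (.reg 101),
  .assign (.reg 102) .mul (.reg 101) (.reg 101),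
  .assign (.reg 102) .sub (.reg 102) (.reg 97)]

/-- A step of Newton's iteration. -/
def sqrtNewton : Prog := block [
  .assign (.reg 102) .div (.reg 97) (.reg 101),
  .assign (.reg 101) .add (.reg 101) (.reg 102),
  .assign (.reg 101) .div (.reg 101) (.const 2),
  .assign (.reg 102) .mul (.reg 101) (.reg 101),
  .assign (.reg 102) .sub (.reg 102) (.reg 97)]

/-- The program that replaces register `101` by the square root of register `97`. -/
def sqrtProg : Prog := block [sqrtInit, .whilePos (.reg 102) sqrtUp, .whilePos (.reg 100) sqrtDown,
  sqrtDouble, .whilePos (.reg 102) sqrtNewton]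

theorem withRegs_self (m : Mem) : m = withRegs m (m 98) (m 99) (m 100) (m 101) (m 102) := by
  funext r
  simp only [withRegs]
  split_ifs with h1 h2 h3 h4 h5
  · rw [h1]
  · rw [h2]
  · rw [h3]
  · rw [h4]
  · rw [h5]
  · rfl

/-- Keeps memories in the normal form `withRegs`, so that `simp` can execute the blocks
symbolically. -/
theorem update_withRegs (m : Mem) (p q i x f v : ℤ) :
    Function.update (withRegs m p q i x f) 98 v = withRegs m v q i x f ∧
    Function.update (withRegs m p q i x f) 99 v = withRegs m p v i x f ∧
    Function.update (withRegs m p q i x f) 100 v = withRegs m p q v x f ∧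
    Function.update (withRegs m p q i x f) 101 v = withRegs m p q i v f ∧
    Function.update (withRegs m p q i x f) 102 v = withRegs m p q i x v := by
  refine ⟨?_, ?_, ?_, ?_, ?_⟩ <;>
  · funext r
    simp only [Function.update_apply, withRegs]
    split_ifs <;> first | rfl | omega

theorem withRegs_apply (m : Mem) (p q i x f : ℤ) :
    withRegs m p q i x f 97 = m 97 ∧ withRegs m p q i x f 98 = p ∧ withRegs m p q i x f 99 = q ∧
    withRegs m p q i x f 100 = i ∧ withRegs m p q i x f 101 = x ∧ withRegs m p q i x f 102 = f :=
  ⟨rfl, rfl, rfl, rfl, rfl, rfl⟩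

theorem exec_sqrtInit (m : Mem) : exec sqrtInit m = withRegs m 1 2 0 1 (m 97 - 3) := by
  conv_lhs => rw [withRegs_self m]
  simp only [sqrtInit, block, exec, Dest.addr, Operand.val, Op.eval, update_withRegs,
    withRegs_apply]
  norm_num

theorem exec_sqrtUp (m : Mem) (p q i x f : ℤ) : exec sqrtUp (withRegs m p q i x f) =
    withRegs m q (p * q) (i + 1) x (m 97 - (p * q) * (p * q) + 1) := by
  simp only [sqrtUp, block, exec, Dest.addr, Operand.val, Op.eval, update_withRegs,
    withRegs_apply, add_zero]

theorem exec_sqrtSelect (m : Mem) (p q i x f : ℤ) : exec sqrtSelect (withRegs m p q i x f) =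
    withRegs m p q i (if 0 < f then x * p else x) f := by
  simp only [sqrtSelect, exec, Dest.addr, Operand.val, Op.eval, update_withRegs, withRegs_apply]
  split_ifs <;> rfl

theorem exec_sqrtDown (m : Mem) (p q i x f : ℤ) : exec sqrtDown (withRegs m p q i x f) =
    withRegs m (q / p) p (i - 1)
      (if 0 < m 97 - (x * p) * (x * p) + 1 then x * p else x) 0 := by
  simp only [sqrtDown, block, exec, Dest.addr, Operand.val, Op.eval, update_withRegs,
    withRegs_apply, exec_sqrtSelect, add_zero]

theorem exec_sqrtDouble (m : Mem) (p q i x f : ℤ) : exec sqrtDouble (withRegs m p q i x f) =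
    withRegs m p q i (x + x) ((x + x) * (x + x) - m 97) := by
  simp only [sqrtDouble, block, exec, Dest.addr, Operand.val, Op.eval, update_withRegs,
    withRegs_apply]

theorem exec_sqrtNewton (m : Mem) (p q i x f : ℤ) : exec sqrtNewton (withRegs m p q i x f) =
    withRegs m p q i ((x + m 97 / x) / 2)
      ((x + m 97 / x) / 2 * ((x + m 97 / x) / 2) - m 97) := by
  simp only [sqrtNewton, block, exec, Dest.addr, Operand.val, Op.eval, update_withRegs,
    withRegs_apply]

/-- By the inequality of the means the step does not fall below `N`, and rounding down is harmless
as `N` is an integer. Convergence is quadratic because `2x(y - N) ≤ (x - N)²` for the new value `y`.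
-/
theorem newton_step {N x : ℤ} (hN : 0 < N) (hx : N ≤ x) :
    N ≤ (x + N ^ 2 / x) / 2 ∧ 2 * N * ((x + N ^ 2 / x) / 2 - N) ≤ (x - N) ^ 2 := by
  have hx0 : 0 < x := by omega
  set g := N ^ 2 / x with hg
  have h1 : g * x ≤ N ^ 2 := Int.ediv_mul_le _ hx0.ne'
  have h2 : N ^ 2 < (g + 1) * x := Int.lt_ediv_add_one_mul_self _ hx0
  set y := (x + g) / 2 with hy
  have h3 : 2 * y ≤ x + g := by omega
  have h4 : x + g ≤ 2 * y + 1 := by omega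
  have h5 : N ≤ y := by
    by_contra h
    -- Then `N² < (g + 1)x ≤ (2N - x)x = N² - (x - N)²`, a contradiction.
    have h6 : g + 1 ≤ 2 * N - x := by omega
    nlinarith [mul_le_mul_of_nonneg_right h6 hx0.le, sq_nonneg (x - N)]
  refine ⟨h5, ?_⟩
  have h7 : 2 * N * (y - N) ≤ 2 * x * (y - N) :=
    mul_le_mul_of_nonneg_right (by omega) (by omega)
  nlinarith [mul_le_mul_of_nonneg_right h3 hx0.le]

theorem two_pow_half_le_fib (k : ℕ) :
    2 ^ k ≤ Nat.fib (2 * k + 1) ∧ 2 ^ k ≤ Nat.fib (2 * k + 2) := by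
  induction k with
  | zero => simp
  | succ k ih =>
    have h1 : Nat.fib (2 * (k + 1) + 1) = Nat.fib (2 * k + 1) + Nat.fib (2 * k + 2) :=
      Nat.fib_add_two
    have h2 : Nat.fib (2 * (k + 1) + 2) = Nat.fib (2 * k + 2) + Nat.fib (2 * (k + 1) + 1) :=
      Nat.fib_add_two
    rw [pow_succ]
    omega

/-- Fibonacci numbers at least double every two steps, so exponents up to `L` are passed after
`O(log L)` steps. -/
theorem le_of_fib_lt {j B : ℕ} (h : Nat.fib (j + 1) < B) : j ≤ 2 * Nat.log 2 B + 1 := by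
  by_contra hj
  have h1 := two_pow_half_le_fib (Nat.log 2 B + 1)
  have h2 : B < 2 ^ (Nat.log 2 B + 1) := Nat.lt_pow_succ_log_self one_lt_two B
  have h3 := Nat.fib_mono (show 2 * (Nat.log 2 B + 1) + 1 ≤ j + 1 by omega)
  omega

end SquareRoot

end LogRAM

namespace LogRAM

/-! ### Correctness and cost of the square root. -/

section SquareRootLoops

theorem LoopFree.exists_step_bound {P : Prog} (hP : LoopFree P) (x : Operand) :
    ∃ C, ∀ (m : Mem) (L : ℕ), Bounded m L →
      x.cost m ≤ C * mulCost L ∧ ∃ t, Runs P m (exec P m) t ∧ t ≤ C * mulCost L := by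
  obtain ⟨c, hc⟩ := hP.exists_bound
  obtain ⟨k, hk⟩ := x.exists_cost_le
  refine ⟨c + k, fun m L h => ?_⟩
  obtain ⟨-, t, ht, ht'⟩ := hc m L h
  have h1 := hk m L h
  have h2 : k * L ≤ k * mulCost L := Nat.mul_le_mul_left _ (le_mulCost L)
  rw [add_mul]
  exact ⟨by omega, t, ht, by omega⟩

/-- One crude bound for all registers at the loop heads: the largest values there are squares of
numbers up to `2 * 2 ^ L`. -/
theorem len_le_six_mul {L : ℕ} (hL : 1 ≤ L) {z : ℤ} (hz : |z| < 16 * (2 ^ L) ^ 2) :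
    len z ≤ 6 * L := by
  rw [len_le_iff (by omega)]
  have h1 : (2 : ℤ) ≤ 2 ^ L := le_self_pow₀ one_le_two (by omega)
  have h2 : (2 : ℤ) ^ 4 ≤ (2 ^ L) ^ 4 := pow_le_pow_left₀ (by norm_num) h1 4
  have h3 : ((z.natAbs : ℕ) : ℤ) < ((2 ^ (6 * L) : ℕ) : ℤ) := by
    rw [Int.natCast_natAbs]
    push_cast
    have h4 : (2 : ℤ) ^ (6 * L) = (2 ^ L) ^ 4 * (2 ^ L) ^ 2 := by
      rw [← pow_mul, ← pow_mul, ← pow_add]; congr 1; ring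
    rw [h4]
    have : (0 : ℤ) < (2 ^ L) ^ 2 := by positivity
    nlinarith
  exact_mod_cast h3

/-- The invariants of the base memory: lengths are at most `L`, and register `97` holds `N²`. -/
structure IsSquareInput (m : Mem) (L : ℕ) (N : ℤ) : Prop where
  bounded : Bounded m L
  one_le : 1 ≤ N
  square : m 97 = N ^ 2

namespace IsSquareInput

variable {m : Mem} {L : ℕ} {N : ℤ}

theorem sq_lt (h : IsSquareInput m L N) : N ^ 2 < 2 ^ L := by
  have h1 := (len_le_iff h.bounded.one_le).1 (h.bounded 97)
  rw [h.square] at h1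
  have h2 : ((N ^ 2).natAbs : ℤ) < ((2 ^ L : ℕ) : ℤ) := by exact_mod_cast h1
  rw [Int.natCast_natAbs, abs_of_nonneg (sq_nonneg N)] at h2
  push_cast at h2
  exact h2

theorem le_sq (h : IsSquareInput m L N) : N ≤ N ^ 2 := by
  have := h.one_le; nlinarith

theorem two_le (h : IsSquareInput m L N) : (2 : ℤ) ≤ 2 ^ L :=
  le_self_pow₀ one_le_two (by have := h.bounded.one_le; omega)

theorem bounded_withRegs (h : IsSquareInput m L N) {p q i x f : ℤ} (hp : |p| ≤ 2 ^ L)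
    (hq : |q| ≤ 2 ^ L) (hi : len i ≤ 6 * L) (hx : |x| ≤ 2 * 2 ^ L) (hf : len f ≤ 6 * L) :
    Bounded (withRegs m p q i x f) (6 * L) := by
  have h1 := h.two_le
  have hL := h.bounded.one_le
  exact LogRAM.bounded_withRegs (h.bounded.mono (by omega))
    (len_le_six_mul hL (by nlinarith)) (len_le_six_mul hL (by nlinarith)) hi
    (len_le_six_mul hL (by nlinarith)) hf

theorem len_counter_le (h : IsSquareInput m L N) {j : ℕ} (hj : j ≤ 2 * Nat.log 2 L + 2) :
    len (j : ℤ) ≤ 6 * L := by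
  have h1 := h.two_le
  have hL := h.bounded.one_le
  have h2 : Nat.log 2 L ≤ L := Nat.log_le_self 2 L
  have h3 : (L : ℤ) < 2 ^ L := by exact_mod_cast Nat.lt_two_pow_self
  refine len_le_six_mul hL ?_
  rw [abs_of_nonneg (by positivity)]
  have h4 : (j : ℤ) ≤ 2 * L + 2 := by exact_mod_cast hj.trans (by omega)
  nlinarith

end IsSquareInput

/-- The pair `2 ^ fib j, 2 ^ fib (j + 1)` moves up by one multiplication and back down by one
division, so the descent needs no stored table of powers. The flag `n - q² + 1` is positive exactly
when `q² ≤ n`; its initial value `n - 3` belongs to `q = 2`. -/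
theorem exists_runs_sqrtUp : ∃ C, ∀ (m : Mem) (L : ℕ) (N : ℤ), IsSquareInput m L N →
    ∃ (j : ℕ) (f : ℤ) (t : ℕ), Runs (.whilePos (.reg 102) sqrtUp)
        (withRegs m 1 2 0 1 (m 97 - 3))
        (withRegs m (2 ^ Nat.fib j) (2 ^ Nat.fib (j + 1)) j 1 f) t ∧
      t ≤ C * ((1 + Nat.log 2 L) * mulCost (6 * L)) ∧ j ≤ 2 * Nat.log 2 L + 2 ∧
      N < 2 ^ Nat.fib (j + 1) ∧ (2 : ℤ) ^ Nat.fib (j + 1) ≤ 2 ^ L ∧ len f ≤ 6 * L := by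
  obtain ⟨C, hC⟩ := LoopFree.exists_step_bound (P := sqrtUp) (by simp [sqrtUp, block, LoopFree])
    (.reg 102)
  refine ⟨5 * C, fun m L N h => ?_⟩
  have hlt := h.sq_lt
  have hle := h.le_sq
  have h2 := h.two_le
  have hN := h.one_le
  have hL := h.bounded.one_le
  set S : ℕ → Mem → Prop := fun k m' => ∃ j : ℕ, j + k = 2 * Nat.log 2 L + 2 ∧
    (2 : ℤ) ^ Nat.fib j ≤ N ∧ (2 : ℤ) ^ Nat.fib (j + 1) ≤ 2 ^ L ∧
    m' = withRegs m (2 ^ Nat.fib j) (2 ^ Nat.fib (j + 1)) j 1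
      (m 97 - 2 ^ Nat.fib (j + 1) * 2 ^ Nat.fib (j + 1) + 1) with hS
  have hflag : ∀ q : ℤ, 0 ≤ q → q ≤ 2 ^ L → len (m 97 - q * q + 1) ≤ 6 * L := by
    intro q hq0 hq
    refine len_le_six_mul hL ?_
    rw [h.square, abs_lt]
    constructor <;> nlinarith
  have hbd : ∀ k m', S k m' → Bounded m' (6 * L) := by
    rintro k m' ⟨j, hj, hp, hq, rfl⟩
    have hp0 : (0 : ℤ) ≤ 2 ^ Nat.fib j := by positivity
    have hq0 : (0 : ℤ) ≤ 2 ^ Nat.fib (j + 1) := by positivity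
    refine h.bounded_withRegs ?_ ?_ (h.len_counter_le (by omega)) ?_ (hflag _ hq0 hq)
    · rw [abs_of_nonneg hp0]; omega
    · rw [abs_of_nonneg hq0]; omega
    · rw [abs_one]; omega
  have hloop := exists_runs_whilePos (x := .reg 102) (P := sqrtUp) S (C * mulCost (6 * L))
    (fun k m' hm' => (hC m' _ (hbd k m' hm')).1) (fun k m' hm' hx => by
      obtain ⟨-, t, ht, htC⟩ := hC m' _ (hbd k m' hm')
      obtain ⟨j, hj, hp, hq, rfl⟩ := hm'
      simp only [Operand.val, withRegs_apply, h.square] at hx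
      have hqN : (2 : ℤ) ^ Nat.fib (j + 1) ≤ N := by
        refine le_of_pow_le_pow_left₀ two_ne_zero (by omega) ?_
        rw [pow_two (2 ^ Nat.fib (j + 1) : ℤ)]; omega
      have hfib : Nat.fib (j + 1) < L := by
        have : (2 : ℤ) ^ Nat.fib (j + 1) < 2 ^ L := by omega
        exact (pow_lt_pow_iff_right₀ (by norm_num)).1 this
      have hjle := le_of_fib_lt hfib
      have hpow : (2 : ℤ) ^ Nat.fib j * 2 ^ Nat.fib (j + 1) = 2 ^ Nat.fib (j + 1 + 1) := by
        rw [← pow_add, Nat.fib_add_two]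
      -- The new larger power stays below `2 ^ L` because it is a product of two powers that are at
      -- most `N`, and `N² < 2 ^ L`.
      refine ⟨2 * Nat.log 2 L + 1 - j, by omega, _, t, ht, htC, j + 1, by omega, hqN, ?_, ?_⟩
      · rw [← hpow]
        have hp0 : (0 : ℤ) ≤ 2 ^ Nat.fib j := by positivity
        nlinarith
      · rw [exec_sqrtUp, hpow]
        push_cast
        rfl)
    (2 * Nat.log 2 L + 2) (withRegs m 1 2 0 1 (m 97 - 3))
    ⟨0, by omega, by simpa using hN, by simpa using h2, by norm_num; congr 1; omega⟩
  obtain ⟨k, m', t, ht, ⟨j, hj, hp, hq, rfl⟩, hx, htC⟩ := hloop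
  have hq0 : (0 : ℤ) ≤ 2 ^ Nat.fib (j + 1) := by positivity
  refine ⟨j, _, t, ht, htC.trans ?_, by omega, ?_, hq, hflag _ hq0 hq⟩
  · calc (2 * (2 * Nat.log 2 L + 2) + 1) * (C * mulCost (6 * L))
        ≤ (5 * (1 + Nat.log 2 L)) * (C * mulCost (6 * L)) := Nat.mul_le_mul_right _ (by omega)
      _ = _ := by ring
  · simp only [Operand.val, withRegs_apply, h.square] at hx
    refine lt_of_pow_lt_pow_left₀ 2 hq0 ?_
    rw [pow_two (2 ^ Nat.fib (j + 1) : ℤ)]; omega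

/-- A greedy choice of Fibonacci exponents builds a power of two `x`. The invariant `x ≤ N < x * 2 ^
fib (k + 1)` ends at `k = 0` with `x ≤ N < 2x`. -/
theorem exists_runs_sqrtDown : ∃ C, ∀ (m : Mem) (L : ℕ) (N : ℤ), IsSquareInput m L N →
    ∀ (j : ℕ) (f : ℤ), j ≤ 2 * Nat.log 2 L + 2 →
      N < 2 ^ Nat.fib (j + 1) → (2 : ℤ) ^ Nat.fib (j + 1) ≤ 2 ^ L → len f ≤ 6 * L →
    ∃ (x f' : ℤ) (t : ℕ), Runs (.whilePos (.reg 100) sqrtDown)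
        (withRegs m (2 ^ Nat.fib j) (2 ^ Nat.fib (j + 1)) j 1 f)
        (withRegs m 1 2 0 x f') t ∧
      t ≤ C * ((1 + Nat.log 2 L) * mulCost (6 * L)) ∧
      1 ≤ x ∧ x ≤ N ∧ N < x * 2 ∧ len f' ≤ 6 * L := by
  obtain ⟨C, hC⟩ := LoopFree.exists_step_bound (P := sqrtDown)
    (by simp [sqrtDown, sqrtSelect, block, LoopFree]) (.reg 100)
  refine ⟨5 * C, fun m L N h j f hj hNq hq hf => ?_⟩
  have hlt := h.sq_lt
  have hle := h.le_sq
  have h2 := h.two_le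
  have hN := h.one_le
  have hL := h.bounded.one_le
  set S : ℕ → Mem → Prop := fun k m' => ∃ x f : ℤ, k ≤ 2 * Nat.log 2 L + 2 ∧ 1 ≤ x ∧ x ≤ N ∧
    N < x * 2 ^ Nat.fib (k + 1) ∧ (2 : ℤ) ^ Nat.fib (k + 1) ≤ 2 ^ L ∧ len f ≤ 6 * L ∧
    m' = withRegs m (2 ^ Nat.fib k) (2 ^ Nat.fib (k + 1)) k x f with hS
  have hmono : ∀ k, (2 : ℤ) ^ Nat.fib k ≤ 2 ^ Nat.fib (k + 1) := fun k =>
    pow_le_pow_right₀ (by norm_num) Nat.fib_le_fib_succ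
  have hbd : ∀ k m', S k m' → Bounded m' (6 * L) := by
    rintro k m' ⟨x, f, hk, hx1, hxN, hNx, hq, hf, rfl⟩
    have hp0 : (0 : ℤ) ≤ 2 ^ Nat.fib k := by positivity
    have hq0 : (0 : ℤ) ≤ 2 ^ Nat.fib (k + 1) := by positivity
    have := hmono k
    refine h.bounded_withRegs ?_ ?_ (h.len_counter_le hk) ?_ hf
    · rw [abs_of_nonneg hp0]; omega
    · rw [abs_of_nonneg hq0]; omega
    · rw [abs_of_pos (by omega)]; omega
  have hloop := exists_runs_whilePos (x := .reg 100) (P := sqrtDown) S (C * mulCost (6 * L))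
    (fun k m' hm' => (hC m' _ (hbd k m' hm')).1) (fun k m' hm' hpos => by
      obtain ⟨-, t, ht, htC⟩ := hC m' _ (hbd k m' hm')
      obtain ⟨x, f, hk, hx1, hxN, hNx, hq, hf, rfl⟩ := hm'
      simp only [Operand.val, withRegs_apply] at hpos
      obtain ⟨k, rfl⟩ : ∃ k', k = k' + 1 := ⟨k - 1, by omega⟩
      have hpow : (2 : ℤ) ^ Nat.fib (k + 1 + 1) = 2 ^ Nat.fib k * 2 ^ Nat.fib (k + 1) := by
        rw [← pow_add, Nat.fib_add_two]
      have hp0 : (0 : ℤ) < 2 ^ Nat.fib (k + 1) := by positivity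
      have hmk := hmono k
      have hmk1 := hmono (k + 1)
      have hexec : exec sqrtDown (withRegs m (2 ^ Nat.fib (k + 1)) (2 ^ Nat.fib (k + 1 + 1))
          (k + 1 : ℕ) x f) = withRegs m (2 ^ Nat.fib k) (2 ^ Nat.fib (k + 1)) k
          (if 0 < m 97 - (x * 2 ^ Nat.fib (k + 1)) * (x * 2 ^ Nat.fib (k + 1)) + 1
            then x * 2 ^ Nat.fib (k + 1) else x) 0 := by
        rw [exec_sqrtDown, hpow, Int.mul_ediv_cancel _ hp0.ne']
        push_cast
        rw [add_sub_cancel_right]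
      rw [hexec] at ht
      refine ⟨k, rfl, _, t, ht, htC, _, 0, by omega, ?_, ?_, ?_, by omega,
        len_le_six_mul hL (by rw [abs_zero]; positivity), rfl⟩
      · split_ifs
        · nlinarith
        · exact hx1
      · split_ifs with hif
        · refine le_of_pow_le_pow_left₀ two_ne_zero (by omega) ?_
          rw [h.square] at hif
          nlinarith
        · exact hxN
      -- If `x` was multiplied, the old bound has the factor `2 ^ fib k` left, which is at most `2 ^
      -- fib (k + 1)`; otherwise the failed test is the bound.
      · split_ifs with hif
        · rw [hpow] at hNx
          have : x * (2 ^ Nat.fib k * 2 ^ Nat.fib (k + 1)) ≤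
              x * (2 ^ Nat.fib (k + 1) * 2 ^ Nat.fib (k + 1) : ℤ) := by gcongr
          linarith
        · rw [h.square] at hif
          refine lt_of_pow_lt_pow_left₀ 2 (by positivity) ?_
          nlinarith)
    j (withRegs m (2 ^ Nat.fib j) (2 ^ Nat.fib (j + 1)) j 1 f)
    ⟨1, f, hj, le_rfl, hN, by rwa [one_mul], hq, hf, rfl⟩
  obtain ⟨k, m', t, ht, ⟨x, f', hk, hx1, hxN, hNx, hq, hf, rfl⟩, hx, htC⟩ := hloop
  simp only [Operand.val, withRegs_apply] at hx
  obtain rfl : k = 0 := by omega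
  refine ⟨x, f', t, by simpa using ht, htC.trans ?_, hx1, hxN, by simpa using hNx, hf⟩
  calc (2 * j + 1) * (C * mulCost (6 * L))
      ≤ (5 * (1 + Nat.log 2 L)) * (C * mulCost (6 * L)) := Nat.mul_le_mul_right _ (by omega)
    _ = _ := by ring

/-- The invariant `(x - N) * 2 ^ (2 ^ j) ≤ 2N` expresses quadratic convergence: each step squares
the factor. It starts at `j = 0` from `x ≤ 2N`. -/
theorem exists_runs_sqrtNewton : ∃ C, ∀ (m : Mem) (L : ℕ) (N : ℤ), IsSquareInput m L N →
    ∀ x : ℤ, N ≤ x → x ≤ 2 * N →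
    ∃ t : ℕ, Runs (.whilePos (.reg 102) sqrtNewton)
        (withRegs m 1 2 0 x (x * x - m 97)) (withRegs m 1 2 0 N 0) t ∧
      t ≤ C * ((1 + Nat.log 2 L) * mulCost (6 * L)) := by
  obtain ⟨C, hC⟩ := LoopFree.exists_step_bound (P := sqrtNewton)
    (by simp [sqrtNewton, block, LoopFree]) (.reg 102)
  refine ⟨3 * C, fun m L N h x₀ hx₀ hx₀' => ?_⟩
  have hlt := h.sq_lt
  have hle := h.le_sq
  have h2 := h.two_le
  have hN := h.one_le
  have hL := h.bounded.one_le
  set S : ℕ → Mem → Prop := fun k m' => ∃ (j : ℕ) (x : ℤ), j + k = Nat.log 2 L + 1 ∧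
    N ≤ x ∧ (x - N) * 2 ^ (2 ^ j) ≤ 2 * N ∧ m' = withRegs m 1 2 0 x (x * x - m 97) with hS
  have hbd : ∀ k m', S k m' → Bounded m' (6 * L) := by
    rintro k m' ⟨j, x, hj, hNx, hx, rfl⟩
    have h3 : (2 : ℤ) ≤ 2 ^ (2 ^ j) := le_self_pow₀ one_le_two (by positivity)
    have h4 : x ≤ 2 * N := by nlinarith
    refine h.bounded_withRegs ?_ ?_ (h.len_counter_le (j := 0) (by omega)) ?_
      (len_le_six_mul hL ?_)
    · rw [abs_one]; omega
    · rw [abs_of_pos (by norm_num)]; omega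
    · rw [abs_of_pos (by omega)]; omega
    · rw [h.square, abs_lt]
      constructor <;> nlinarith
  have hloop := exists_runs_whilePos (x := .reg 102) (P := sqrtNewton) S (C * mulCost (6 * L))
    (fun k m' hm' => (hC m' _ (hbd k m' hm')).1) (fun k m' hm' hpos => by
      obtain ⟨-, t, ht, htC⟩ := hC m' _ (hbd k m' hm')
      obtain ⟨j, x, hj, hNx, hx, rfl⟩ := hm'
      simp only [Operand.val, withRegs_apply, h.square] at hpos
      -- Once `2 ^ j > L`, the factor is at least `2 ^ (L + 1) > 2N`, so `x = N` and the loop test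
      -- fails.
      have hk : k ≠ 0 := by
        rintro rfl
        have h3 : L < 2 ^ j := by
          rw [show j = Nat.log 2 L + 1 by omega]
          exact Nat.lt_pow_succ_log_self one_lt_two L
        have h4 : (2 : ℤ) ^ (L + 1) ≤ 2 ^ (2 ^ j) := pow_le_pow_right₀ (by norm_num) h3
        rw [pow_succ] at h4
        have h5 : x = N := by
          by_contra hne
          have : 1 ≤ x - N := by omega
          nlinarith
        subst h5
        nlinarith
      obtain ⟨k, rfl⟩ : ∃ k', k = k' + 1 := ⟨k - 1, by omega⟩
      obtain ⟨h3, h4⟩ := newton_step (by omega) hNx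
      rw [exec_sqrtNewton] at ht
      refine ⟨k, rfl, _, t, ht, htC, j + 1, _, by omega, ?_, ?_, rfl⟩
      · rw [h.square]; exact h3
      rw [h.square]
      set y := (x + N ^ 2 / x) / 2
      set E : ℤ := 2 ^ (2 ^ j) with hE
      have hE0 : 0 < E := by positivity
      have hE2 : (2 : ℤ) ^ (2 ^ (j + 1)) = E ^ 2 := by
        rw [hE, ← pow_mul, pow_succ]
      rw [hE2]
      have h5 : ((x - N) * E) ^ 2 ≤ (2 * N) ^ 2 :=
        pow_le_pow_left₀ (mul_nonneg (by omega) hE0.le) hx 2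
      have h6 : 2 * N * (y - N) * E ^ 2 ≤ (x - N) ^ 2 * E ^ 2 :=
        mul_le_mul_of_nonneg_right h4 (by positivity)
      have h7 : (2 * N) * ((y - N) * E ^ 2) ≤ (2 * N) * (2 * N) := by nlinarith
      exact le_of_mul_le_mul_left h7 (by omega))
    (Nat.log 2 L + 1) (withRegs m 1 2 0 x₀ (x₀ * x₀ - m 97))
    ⟨0, x₀, by omega, hx₀, by norm_num; omega, rfl⟩
  obtain ⟨k, m', t, ht, ⟨j, x, hj, hNx, hx, rfl⟩, hpos, htC⟩ := hloop
  simp only [Operand.val, withRegs_apply, h.square] at hpos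
  obtain rfl : x = N := by nlinarith
  have h0 : x * x - m 97 = 0 := by rw [h.square]; ring
  rw [h0] at ht
  refine ⟨t, ht, htC.trans ?_⟩
  calc (2 * (Nat.log 2 L + 1) + 1) * (C * mulCost (6 * L))
      ≤ (3 * (1 + Nat.log 2 L)) * (C * mulCost (6 * L)) := Nat.mul_le_mul_right _ (by omega)
    _ = _ := by ring

theorem exists_runs_sqrtProg : ∃ C, ∀ (m : Mem) (L : ℕ) (N : ℤ), IsSquareInput m L N →
    ∃ t : ℕ, Runs sqrtProg m (withRegs m 1 2 0 N 0) t ∧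
      t ≤ C * ((1 + Nat.log 2 L) * mulCost L) ∧ Bounded (withRegs m 1 2 0 N 0) (6 * L) := by
  obtain ⟨c₁, h₁⟩ := LoopFree.exists_step_bound (P := sqrtInit)
    (by simp [sqrtInit, block, LoopFree]) (.reg 0)
  obtain ⟨c₂, h₂⟩ := exists_runs_sqrtUp
  obtain ⟨c₃, h₃⟩ := exists_runs_sqrtDown
  obtain ⟨c₄, h₄⟩ := LoopFree.exists_step_bound (P := sqrtDouble)
    (by simp [sqrtDouble, block, LoopFree]) (.reg 0)
  obtain ⟨c₅, h₅⟩ := exists_runs_sqrtNewton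
  refine ⟨(c₁ + c₂ + c₃ + c₄ + c₅ + 1) * (6 * (2 + Nat.log 2 6) ^ 2), fun m L N h => ?_⟩
  have h2 := h.two_le
  have hN := h.one_le
  have hlt := h.sq_lt
  have hle := h.le_sq
  have hL := h.bounded.one_le
  obtain ⟨-, t₁, r₁, b₁⟩ := h₁ m (6 * L) (h.bounded.mono (by omega))
  obtain ⟨j, f, t₂, r₂, b₂, hj, hNj, hjL, hf⟩ := h₂ m L N h
  obtain ⟨x, f', t₃, r₃, b₃, hx1, hxN, hNx, hf'⟩ := h₃ m L N h j f hj hNj hjL hf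
  obtain ⟨-, t₄, r₄, b₄⟩ := h₄ (withRegs m 1 2 0 x f') (6 * L)
    (h.bounded_withRegs (by rw [abs_one]; omega) (by rw [abs_of_pos (by norm_num)]; omega)
      (h.len_counter_le (j := 0) (by omega)) (by rw [abs_of_pos (by omega)]; omega) hf')
  obtain ⟨t₅, r₅, b₅⟩ := h₅ m L N h (x + x) (by omega) (by omega)
  rw [exec_sqrtInit] at r₁
  rw [exec_sqrtDouble] at r₄
  refine ⟨_, .seq r₁ (.seq r₂ (.seq r₃ (.seq r₄ (.seq r₅ (.skip _))))), ?_, ?_⟩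
  · set W := (1 + Nat.log 2 L) * mulCost (6 * L) with hW
    have hW1 : mulCost (6 * L) ≤ W := Nat.le_mul_of_pos_left _ (by omega)
    have hW2 : 1 ≤ W := le_trans (by omega) ((le_mulCost (6 * L)).trans hW1)
    have e₁ : c₁ * mulCost (6 * L) ≤ c₁ * W := Nat.mul_le_mul_left _ hW1
    have e₄ : c₄ * mulCost (6 * L) ≤ c₄ * W := Nat.mul_le_mul_left _ hW1
    have e₆ : (c₁ + c₂ + c₃ + c₄ + c₅ + 1) * W ≤ (c₁ + c₂ + c₃ + c₄ + c₅ + 1) *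
        ((1 + Nat.log 2 L) * (6 * (2 + Nat.log 2 6) ^ 2 * mulCost L)) :=
      Nat.mul_le_mul_left _ (Nat.mul_le_mul_left _ (mulCost_mul_le 6 L))
    have e₇ : (c₁ + c₂ + c₃ + c₄ + c₅ + 1) * (6 * (2 + Nat.log 2 6) ^ 2) *
        ((1 + Nat.log 2 L) * mulCost L) = (c₁ + c₂ + c₃ + c₄ + c₅ + 1) *
        ((1 + Nat.log 2 L) * (6 * (2 + Nat.log 2 6) ^ 2 * mulCost L)) := by ring
    rw [e₇]
    refine le_trans ?_ e₆
    simp only [add_mul, one_mul]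
    omega
  · exact h.bounded_withRegs (by rw [abs_one]; omega) (by rw [abs_of_pos (by norm_num)]; omega)
      (h.len_counter_le (j := 0) (by omega)) (by rw [abs_of_pos (by omega)]; omega)
      (h.len_counter_le (j := 0) (by omega))

end SquareRootLoops

end LogRAM

namespace LogRAM

/-! ### Computing the index, and the complete program. -/

section DeterminantExpressions

namespace Expr

/-- The sum of two expressions. -/
def add (e f : Expr) : Expr := .op .add e f

/-- The difference of two expressions. -/
def sub (e f : Expr) : Expr := .op .sub e f

/-- The product of two expressions. -/
def mul (e f : Expr) : Expr := .op .mul e f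

/-- The determinant of a matrix of size three. -/
def det3 (A : Fin 3 → Fin 3 → Expr) : Expr :=
  add (sub
    (mul (A 0 0) (sub (mul (A 1 1) (A 2 2)) (mul (A 1 2) (A 2 1))))
    (mul (A 0 1) (sub (mul (A 1 0) (A 2 2)) (mul (A 1 2) (A 2 0)))))
    (mul (A 0 2) (sub (mul (A 1 0) (A 2 1)) (mul (A 1 1) (A 2 0))))

/-- The determinant of a matrix of size four. -/
def det4 (A : Fin 4 → Fin 4 → Expr) : Expr :=
  add (sub
    (mul (A 0 0) (det3 fun i j => A i.succ (Fin.succAbove 0 j)))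
    (mul (A 0 1) (det3 fun i j => A i.succ (Fin.succAbove 1 j))))
  (sub
    (mul (A 0 2) (det3 fun i j => A i.succ (Fin.succAbove 2 j)))
    (mul (A 0 3) (det3 fun i j => A i.succ (Fin.succAbove 3 j))))

theorem eval_det3 (m : Mem) (A : Fin 3 → Fin 3 → Expr) :
    (det3 A).eval m = (Matrix.of fun i j => (A i j).eval m).det := by
  simp only [det3, add, sub, mul, eval, Op.eval, Matrix.det_fin_three, Matrix.of_apply]
  ring

theorem eval_det4 (m : Mem) (A : Fin 4 → Fin 4 → Expr) :
    (det4 A).eval m = (Matrix.of fun i j => (A i j).eval m).det := by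
  rw [Matrix.det_succ_row_zero, Fin.sum_univ_four]
  simp only [det4, add, sub, mul, eval, Op.eval, eval_det3, Matrix.of_apply]
  have : ∀ j, (Matrix.of fun i j => (A i j).eval m).submatrix Fin.succ (Fin.succAbove j) =
      Matrix.of fun i k => (A i.succ (Fin.succAbove j k)).eval m := fun j => rfl
  simp only [this]
  norm_num [Fin.val_two]
  ring

theorem reads_det4 {p : ℕ → Prop} {A : Fin 4 → Fin 4 → Expr} (h : ∀ i j, (A i j).Reads p) :
    (det4 A).Reads p := by
  simp [det4, det3, add, sub, mul, Reads, h]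

/-- The common denominator of the `r`-th quaternion stored from `s` on. -/
def rowDen (s r : ℕ) : Expr :=
  mul (mul (.reg (s + 8 * r + 1)) (.reg (s + 8 * r + 3)))
    (mul (.reg (s + 8 * r + 5)) (.reg (s + 8 * r + 7)))

/-- The coordinates of the `r`-th quaternion stored from `s` on, times their common
denominator. -/
def rowEntry (s r : ℕ) : Fin 4 → Expr :=
  ![mul (.reg (s + 8 * r)) (mul (.reg (s + 8 * r + 3))
      (mul (.reg (s + 8 * r + 5)) (.reg (s + 8 * r + 7)))),
    mul (.reg (s + 8 * r + 2)) (mul (.reg (s + 8 * r + 1))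
      (mul (.reg (s + 8 * r + 5)) (.reg (s + 8 * r + 7)))),
    mul (.reg (s + 8 * r + 4)) (mul (.reg (s + 8 * r + 1))
      (mul (.reg (s + 8 * r + 3)) (.reg (s + 8 * r + 7)))),
    mul (.reg (s + 8 * r + 6)) (mul (.reg (s + 8 * r + 1))
      (mul (.reg (s + 8 * r + 3)) (.reg (s + 8 * r + 5))))]

/-- The common denominator of the four quaternions stored from `s` on. -/
def basisDen (s : ℕ) : Expr :=
  mul (mul (rowDen s 0) (rowDen s 1)) (mul (rowDen s 2) (rowDen s 3))

/-- The determinant of the four quaternions stored from `s` on, times their common denominator. -/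
def basisDet (s : ℕ) : Expr := det4 fun i => rowEntry s i

/-- The quotient of the determinants of the bases stored from `65` on and from `1` on. -/
def indexExpr : Expr :=
  .op .div (mul (basisDet 65) (basisDen 1)) (mul (basisDet 1) (basisDen 65))

theorem reads_indexExpr : indexExpr.Reads (· < 200) := by
  have h1 : ∀ s, s ≤ 65 → (basisDet s).Reads (· < 200) := fun s hs => reads_det4 fun i j => by
    have := i.isLt
    fin_cases j <;> simp [rowEntry, mul, Reads] <;> omega
  have h2 : ∀ s, s ≤ 65 → (basisDen s).Reads (· < 200) := fun s hs => by
    simp [basisDen, rowDen, mul, Reads]; omega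
  exact ⟨⟨h1 _ le_rfl, h2 _ (by norm_num)⟩, ⟨h1 _ (by norm_num), h2 _ le_rfl⟩⟩

theorem eval_basisDen_ne_zero {m : Mem} {s : ℕ} (hm : ∀ e < 16, 0 < m (s + 2 * e + 1)) :
    (basisDen s).eval m ≠ 0 := by
  have h : ∀ r < 4, (rowDen s r).eval m ≠ 0 := fun r hr => by
    simp only [rowDen, mul, eval, Op.eval]
    have h0 := (hm (4 * r) (by omega)).ne'
    have h1 := (hm (4 * r + 1) (by omega)).ne'
    have h2 := (hm (4 * r + 2) (by omega)).ne'
    have h3 := (hm (4 * r + 3) (by omega)).ne'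
    rw [show s + 2 * (4 * r) + 1 = s + 8 * r + 1 by ring] at h0
    rw [show s + 2 * (4 * r + 1) + 1 = s + 8 * r + 3 by ring] at h1
    rw [show s + 2 * (4 * r + 2) + 1 = s + 8 * r + 5 by ring] at h2
    rw [show s + 2 * (4 * r + 3) + 1 = s + 8 * r + 7 by ring] at h3
    exact mul_ne_zero (mul_ne_zero h0 h1) (mul_ne_zero h2 h3)
  exact mul_ne_zero (mul_ne_zero (h 0 (by norm_num)) (h 1 (by norm_num)))
    (mul_ne_zero (h 2 (by norm_num)) (h 3 (by norm_num)))

/-- Each row is scaled by the product of its four denominators, and the determinant is multilinear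
in the rows. -/
theorem eval_basisDet {a b : ℚ} {m : Mem} {s : ℕ} (hm : ∀ e < 16, 0 < m (s + 2 * e + 1)) :
    ((basisDet s).eval m : ℚ) =
      (basisDen s).eval m * (coordMatrix (storedQuat a b m s)).det := by
  have h1 : (Matrix.of fun i j => (rowEntry s (i : Fin 4) j).eval m).map (Int.castRingHom ℚ) =
      Matrix.of fun i j : Fin 4 => ((rowDen s i).eval m : ℚ) *
        coordMatrix (storedQuat a b m s) i j := by
    ext i j
    have hi := i.isLt
    have h0 := (hm (4 * i) (by omega)).ne'
    have h1 := (hm (4 * i + 1) (by omega)).ne'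
    have h2 := (hm (4 * i + 2) (by omega)).ne'
    have h3 := (hm (4 * i + 3) (by omega)).ne'
    rw [show s + 2 * (4 * i) + 1 = s + 8 * i + 1 by ring] at h0
    rw [show s + 2 * (4 * i + 1) + 1 = s + 8 * i + 3 by ring] at h1
    rw [show s + 2 * (4 * i + 2) + 1 = s + 8 * i + 5 by ring] at h2
    rw [show s + 2 * (4 * i + 3) + 1 = s + 8 * i + 7 by ring] at h3
    rw [← Int.cast_ne_zero (α := ℚ)] at h0 h1 h2 h3
    fin_cases j <;>
    · simp only [coordMatrix, rowEntry, rowDen, mul, eval, Op.eval, Matrix.of_apply,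
        Matrix.map_apply, storedQuat, Fin.zero_eta, Fin.mk_one, Fin.reduceFinMk,
        Matrix.cons_val, Int.coe_castRingHom, Int.cast_mul]
      field_simp
  have h2 := RingHom.map_det (Int.castRingHom ℚ)
    (Matrix.of fun i j => (rowEntry s (i : Fin 4) j).eval m)
  rw [RingHom.mapMatrix_apply, h1, Matrix.det_mul_column, ← eval_det4 m fun i => rowEntry s i] at h2
  refine h2.trans ?_
  congr 1
  rw [Fin.prod_univ_four]
  simp only [basisDen, mul, eval, Op.eval]
  push_cast
  norm_num
  ring

end Expr

/-- The division in `indexExpr` is exact, as the determinants differ by the integer factor `± N²`;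
the sign depends on the orientations of the given bases. -/
theorem abs_eval_indexExpr {a b : ℚ} {O₁ O₂ : Subalgebra ℤ ℍ[ℚ, a, b]}
    {I J : Submodule ℤ ℍ[ℚ, a, b]} {d : ℤ} (h : IsIntegerIdealDivision O₁ O₂ I J d) {m : Mem}
    (hm : IsDivisionInput m O₁ O₂ I d) {N : ℕ} (hN : IsLatticeNorm I N) :
    |Expr.indexExpr.eval m| = (N : ℤ) ^ 2 := by
  have h1 := Expr.eval_basisDet (a := a) (b := b) hm.basis₁.1
  have h2 := Expr.eval_basisDet (a := a) (b := b) hm.basis_ideal.1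
  have h3 := Expr.eval_basisDen_ne_zero hm.basis₁.1
  have h4 := Expr.eval_basisDen_ne_zero hm.basis_ideal.1
  have h5 := coordMatrix_det_ne_zero hm.basis₁.2
  have h6 : (Expr.basisDet 1).eval m ≠ 0 := by
    rw [← Int.cast_ne_zero (α := ℚ), h1]
    exact mul_ne_zero (Int.cast_ne_zero.2 h3) h5
  have h7 : (Expr.basisDet 1).eval m * (Expr.basisDen 65).eval m ≠ 0 := mul_ne_zero h6 h4
  simp only [Expr.indexExpr, Expr.eval, Expr.mul, Op.eval]
  rcases h.abs_det_eq hN hm.basis₁.2 hm.basis_ideal.2 with h8 | h8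
  · have h9 : (Expr.basisDet 65).eval m * (Expr.basisDen 1).eval m =
        (N : ℤ) ^ 2 * ((Expr.basisDet 1).eval m * (Expr.basisDen 65).eval m) := by
      have : (((Expr.basisDet 65).eval m * (Expr.basisDen 1).eval m : ℤ) : ℚ) =
          (((N : ℤ) ^ 2 * ((Expr.basisDet 1).eval m * (Expr.basisDen 65).eval m) : ℤ) : ℚ) := by
        push_cast
        rw [h1, h2, h8]
        ring
      exact_mod_cast this
    rw [h9, Int.mul_ediv_cancel _ h7, abs_of_nonneg (by positivity)]
  · have h9 : (Expr.basisDet 65).eval m * (Expr.basisDen 1).eval m =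
        -(N : ℤ) ^ 2 * ((Expr.basisDet 1).eval m * (Expr.basisDen 65).eval m) := by
      have : (((Expr.basisDet 65).eval m * (Expr.basisDen 1).eval m : ℤ) : ℚ) =
          ((-(N : ℤ) ^ 2 * ((Expr.basisDet 1).eval m * (Expr.basisDen 65).eval m) : ℤ) : ℚ) := by
        push_cast
        rw [h1, h2, h8]
        ring
      exact_mod_cast this
    rw [h9, Int.mul_ediv_cancel _ h7, abs_neg, abs_of_nonneg (by positivity)]

/-- The program that replaces register `97` by its absolute value. -/
def absProg : Prog :=
  .ifPos (.reg 97) .skip (.assign (.reg 97) .sub (.const 0) (.reg 97))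

theorem exec_absProg (m : Mem) : exec absProg m = Function.update m 97 |m 97| := by
  simp only [absProg, exec, Operand.val, Dest.addr, Op.eval, zero_sub]
  split_ifs with h
  · rw [abs_of_pos h, Function.update_eq_self]
  · rw [abs_of_nonpos (by omega)]

/-- The program that stores the index of `I` in `O₁` in register `97`. -/
def indexProg : Prog := block [
  Expr.indexExpr.compile 200,
  .assign (.reg 97) .add (.reg 200) (.const 0),
  absProg]

theorem loopFree_indexProg : LoopFree indexProg :=
  ⟨Expr.loopFree_compile _ _, trivial, ⟨trivial, trivial⟩, trivial⟩

theorem exec_indexProg (m : Mem) : exec indexProg m 97 = |Expr.indexExpr.eval m| ∧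
    ∀ r < 97, exec indexProg m r = m r := by
  obtain ⟨h1, h2⟩ := Expr.exec_compile Expr.reads_indexExpr m
  simp only [indexProg, block, exec, exec_absProg, Dest.addr, Operand.val, Op.eval, add_zero, h1]
  refine ⟨by rw [Function.update_self, Function.update_self], fun r hr => ?_⟩
  rw [Function.update_of_ne (by omega), Function.update_of_ne (by omega), h2 r (by omega)]

/-- The numerators and denominators of the basis of `J`. -/
def outExpr (e : ℕ) : Expr :=
  if e % 2 = 1 then .mul (.reg (65 + e)) (.reg 101)
  else if e % 8 = 0 then .mul (.reg (65 + e)) (.reg 103)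
  else .mul (.sub (.const 0) (.reg (65 + e))) (.reg 103)

/-- The program that stores the basis of `J`. -/
def outProg : Prog :=
  .seq (.assign (.reg 103) .add (.reg 0) (.const 0)) (storeAll outExpr 200 32)

theorem loopFree_outProg : LoopFree outProg := ⟨trivial, loopFree_storeAll _ _ _⟩

/-- Odd positions are denominators, multiplied by `N`. Numerators are multiplied by `d`, and
conjugation negates all but the real ones, at multiples of `8`. Since the output overwrites register
`0`, `d` is read from a copy in register `103`. -/
theorem exec_outProg (m : Mem) {e : ℕ} (he : e < 32) : exec outProg m e =
    if e % 2 = 1 then m (65 + e) * m 101 else if e % 8 = 0 then m (65 + e) * m 0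
    else -(m (65 + e) * m 0) := by
  have h1 : ∀ k < 32, (outExpr k).Reads fun r => 65 ≤ r ∧ r < 200 := by
    intro k hk
    unfold outExpr
    split_ifs <;> simp [Expr.mul, Expr.sub, Expr.Reads] <;> omega
  simp only [outProg, exec]
  rw [exec_storeAll (by norm_num) h1 _ e (by omega), if_pos he]
  simp only [Dest.addr, Operand.val, Op.eval, add_zero, outExpr]
  split_ifs <;>
  · simp only [Expr.mul, Expr.sub, Expr.eval, Op.eval, Function.update_self]
    repeat rw [Function.update_of_ne (by omega)]
    try ring

/-- The program that computes a basis of `J`. -/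
def divisionProg : Prog := .seq indexProg (.seq sqrtProg outProg)

theorem storedQuat_exec_outProg (a b : ℚ) {m m' : Mem} {d N : ℤ} (h0 : m 0 = d) (hN : m 101 = N)
    (hm : ∀ r < 97, m r = m' r) (r : Fin 4) :
    storedQuat a b (exec outProg m) 0 r = ((d : ℚ) / N) • star (storedQuat a b m' 65 r) := by
  rw [hm 0 (by norm_num)] at h0
  fin_cases r <;>
  · ext <;>
    · simp [storedQuat, exec_outProg, hm, h0, hN]
      ring

/-- Lengths grow from `L` to `c₁ * L` in the index computation and to `6 * (c₁ * L)` in the square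
root; the constants depend on the program alone. -/
theorem exists_runs_divisionProg : ∃ C : ℕ,
    ∀ (a b : ℚ) (O₁ O₂ : Subalgebra ℤ ℍ[ℚ, a, b]) (I J : Submodule ℤ ℍ[ℚ, a, b]) (d : ℤ),
      IsIntegerIdealDivision O₁ O₂ I J d →
      ∀ (m : Mem) (L : ℕ), IsDivisionInput m O₁ O₂ I d → Bounded m L →
        ∃ (m' : Mem) (t : ℕ), Runs divisionProg m m' t ∧ StoresBasis m' 0 J ∧
          t ≤ C * ((1 + Nat.log 2 L) * mulCost L) := by
  obtain ⟨c₁, h₁⟩ := loopFree_indexProg.exists_bound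
  obtain ⟨c₂, h₂⟩ := exists_runs_sqrtProg
  obtain ⟨c₃, h₃⟩ := loopFree_outProg.exists_bound
  refine ⟨c₁ + c₂ * ((2 + Nat.log 2 c₁) * (c₁ * (2 + Nat.log 2 c₁) ^ 2)) +
    c₃ * (6 * c₁ * (2 + Nat.log 2 (6 * c₁)) ^ 2), fun a b O₁ O₂ I J d h m L hm hL => ?_⟩
  obtain ⟨N, hN⟩ := h.exists_norm
  have hN0 : (0 : ℤ) < N := by exact_mod_cast hN.pos
  obtain ⟨b₁, t₁, r₁, e₁⟩ := h₁ m L hL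
  obtain ⟨hi, hi'⟩ := exec_indexProg m
  rw [abs_eval_indexExpr h hm hN] at hi
  obtain ⟨t₂, r₂, e₂, b₂⟩ := h₂ _ _ N ⟨b₁, by omega, hi⟩
  obtain ⟨-, t₃, r₃, e₃⟩ := h₃ _ _ b₂
  have hbase : ∀ r < 97, withRegs (exec indexProg m) 1 2 0 N 0 r = m r := fun r hr => by
    rw [withRegs_eq (by omega), hi' r hr]
  refine ⟨_, _, .seq r₁ (.seq r₂ r₃), ⟨fun e he => ?_, ?_⟩, ?_⟩
  · rw [exec_outProg _ (by omega), if_pos (by omega), hbase _ (by omega)]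
    have := hm.basis_ideal.1 e he
    rw [show 65 + (0 + 2 * e + 1) = 65 + 2 * e + 1 by ring]
    exact mul_pos this hN0
  · have h4 : storedQuat a b (exec outProg (withRegs (exec indexProg m) 1 2 0 N 0)) 0 =
        fun r => ((d : ℚ) / N) • star (storedQuat a b m 65 r) := by
      funext r
      refine storedQuat_exec_outProg a b ?_ rfl hbase r
      rw [hbase 0 (by norm_num), hm.integer]
    rw [h4]
    exact h.isZBasis hN hm.basis_ideal.2
  · have f₁ : mulCost L ≤ (1 + Nat.log 2 L) * mulCost L := Nat.le_mul_of_pos_left _ (by omega)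
    have f₂ : c₂ * ((1 + Nat.log 2 (c₁ * L)) * mulCost (c₁ * L)) ≤
        c₂ * (((2 + Nat.log 2 c₁) * (1 + Nat.log 2 L)) *
          (c₁ * (2 + Nat.log 2 c₁) ^ 2 * mulCost L)) :=
      Nat.mul_le_mul_left _ (Nat.mul_le_mul (log_mul_le _ _) (mulCost_mul_le _ _))
    have f₃ : c₃ * mulCost (6 * (c₁ * L)) ≤
        c₃ * (6 * c₁ * (2 + Nat.log 2 (6 * c₁)) ^ 2 * mulCost L) := by
      rw [← mul_assoc 6]
      exact Nat.mul_le_mul_left _ (mulCost_mul_le _ _)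
    calc t₁ + (t₂ + t₃)
        ≤ c₁ * ((1 + Nat.log 2 L) * mulCost L) + (c₂ * (((2 + Nat.log 2 c₁) * (1 + Nat.log 2 L)) *
          (c₁ * (2 + Nat.log 2 c₁) ^ 2 * mulCost L)) +
          c₃ * (6 * c₁ * (2 + Nat.log 2 (6 * c₁)) ^ 2 * ((1 + Nat.log 2 L) * mulCost L))) :=
          Nat.add_le_add (e₁.trans (Nat.mul_le_mul_left _ f₁)) (Nat.add_le_add (e₂.trans f₂)
            ((e₃.trans f₃).trans (Nat.mul_le_mul_left _ (Nat.mul_le_mul_left _ f₁))))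
      _ = _ := by ring

end DeterminantExpressions

/-! ### From bit lengths to the quasi-linear bound. -/

section SoftLinear

theorem IsDivisionInput.bounded {a b : ℚ} {O₁ O₂ : Subalgebra ℤ ℍ[ℚ, a, b]}
    {I : Submodule ℤ ℍ[ℚ, a, b]} {d : ℤ} {m : Mem} (hm : IsDivisionInput m O₁ O₂ I d) :
    Bounded m (max 1 (Nat.size (inputHeight m))) := by
  intro r
  refine max_le_max le_rfl (Nat.size_le_size ?_)
  by_cases hr : r < 97
  · exact Finset.le_sup (f := fun n => (m n).natAbs) (Finset.mem_range.2 hr)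
  · rw [hm.blank r (by omega)]
    simp

/-- With `X = 1 + log g`, the estimate `log 2 ≥ 1/2` gives `L ≤ 2X` and `1 + log₂ L ≤ 2(1 + log X)`.
The exponent `3` is two from multiplication and one from the iteration count, and `16 = 2 * 2³`. -/
theorem cost_le_softLinear (C : ℕ) {g : ℕ} (hg : 1 ≤ g) :
    ((C * ((1 + Nat.log 2 (max 1 (Nat.size g))) * mulCost (max 1 (Nat.size g))) : ℕ) : ℝ) ≤
      softLinear (16 * C) 3 (Real.log g) := by
  set L := max 1 (Nat.size g) with hL
  have hL1 : 1 ≤ L := le_max_left _ _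
  have hln2 : 1 / 2 ≤ Real.log 2 := by have := Real.log_two_gt_d9; linarith
  have hg0 : (1 : ℝ) ≤ g := by exact_mod_cast hg
  have hlogg : 0 ≤ Real.log g := Real.log_nonneg hg0
  set X : ℝ := 1 + Real.log g with hX
  have hX1 : 1 ≤ X := by linarith
  have hlogX : 0 ≤ Real.log X := Real.log_nonneg hX1
  have h1 : (L : ℝ) ≤ 2 * X := by
    have h2 : 2 ^ (L - 1) ≤ g := by
      rw [← Nat.lt_size]
      have : 1 ≤ Nat.size g := Nat.lt_size.2 (by simpa using hg)
      omega
    have h3 : ((2 : ℝ)) ^ (L - 1) ≤ g := by exact_mod_cast h2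
    have h4 := Real.log_le_log (by positivity) h3
    rw [Real.log_pow, Nat.cast_sub hL1, Nat.cast_one] at h4
    have h5 : (0 : ℝ) ≤ (L : ℝ) - 1 := by
      have : (1 : ℝ) ≤ L := by exact_mod_cast hL1
      linarith
    nlinarith
  have h2 : (1 + Nat.log 2 L : ℝ) ≤ 2 * (1 + Real.log X) := by
    have h3 : ((2 : ℝ)) ^ (Nat.log 2 L) ≤ L := by
      exact_mod_cast Nat.pow_log_le_self 2 (by omega)
    have h4 := Real.log_le_log (by positivity) (h3.trans h1)
    rw [Real.log_pow, Real.log_mul (by norm_num) (by linarith)] at h4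
    have h5 : ((Nat.log 2 L : ℝ) - 1) * Real.log 2 ≤ Real.log X := by linarith
    by_cases h6 : (Nat.log 2 L : ℝ) - 1 ≤ 0
    · linarith
    · nlinarith
  have h3 : (1 + Nat.log 2 L : ℝ) ^ 3 ≤ (2 * (1 + Real.log X)) ^ 3 :=
    pow_le_pow_left₀ (by positivity) h2 3
  calc ((C * ((1 + Nat.log 2 L) * mulCost L) : ℕ) : ℝ)
      = C * (L * (1 + Nat.log 2 L : ℝ) ^ 3) := by unfold mulCost; push_cast; ring
    _ ≤ C * ((2 * X) * (2 * (1 + Real.log X)) ^ 3) := by gcongr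
    _ = softLinear (16 * C) 3 (Real.log g) := by unfold softLinear; ring

theorem IsDivisionInput.one_le_height {a b : ℚ} {O₁ O₂ : Subalgebra ℤ ℍ[ℚ, a, b]}
    {I : Submodule ℤ ℍ[ℚ, a, b]} {d : ℤ} {m : Mem} (hm : IsDivisionInput m O₁ O₂ I d) :
    1 ≤ inputHeight m := by
  -- Register `2` holds the first denominator of the basis of `O₁`, which is positive.
  have h1 := hm.basis₁.1 0 (by norm_num)
  have h2 : (m 2).natAbs ≤ inputHeight m :=
    Finset.le_sup (f := fun n => (m n).natAbs) (Finset.mem_range.2 (by norm_num))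
  have h3 : 0 < m 2 := h1
  omega

end SoftLinear

end LogRAM

theorem mainTheorem11 :
    (∀ (p : ℕ) (a b : ℚ), p.Prime → IsBpInfty p a b →
      ∀ (O₁ O₂ : Subalgebra ℤ ℍ[ℚ, a, b]) (I J : Submodule ℤ ℍ[ℚ, a, b]) (d : ℤ),
        IsIntegerIdealDivision O₁ O₂ I J d →
        (J : Set ℍ[ℚ, a, b]) =
          {s | s ∈ O₁ ∧ s ∈ O₂ ∧ ∀ x ∈ I, x * s ∈ principalLeftIdeal O₁ (d : ℍ[ℚ, a, b])}) ∧
    (∃ (P : LogRAM.Prog) (C : ℝ) (k : ℕ),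
      ∀ (p : ℕ) (a b : ℚ), p.Prime → IsBpInfty p a b →
      ∀ (O₁ O₂ : Subalgebra ℤ ℍ[ℚ, a, b]) (I J : Submodule ℤ ℍ[ℚ, a, b]) (d : ℤ),
        IsIntegerIdealDivision O₁ O₂ I J d →
        ∀ m : LogRAM.Mem, IsDivisionInput m O₁ O₂ I d →
          ∃ (m' : LogRAM.Mem) (t : ℕ), LogRAM.Runs P m m' t ∧ StoresBasis m' 0 J ∧
            (t : ℝ) ≤ softLinear C k (Real.log (inputHeight m))) := by
  refine ⟨fun p a b _ _ O₁ O₂ I J d h => h.coe_eq, ?_⟩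
  obtain ⟨C, hC⟩ := LogRAM.exists_runs_divisionProg
  refine ⟨LogRAM.divisionProg, 16 * C, 3, fun p a b _ _ O₁ O₂ I J d h m hm => ?_⟩
  obtain ⟨m', t, hr, hs, ht⟩ := hC a b O₁ O₂ I J d h m _ hm (LogRAM.IsDivisionInput.bounded hm)
  exact ⟨m', t, hr, hs, (Nat.cast_le.2 ht).trans
    (LogRAM.cost_le_softLinear C (LogRAM.IsDivisionInput.one_le_height hm))⟩
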